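/- **Theorem 2 (Limiting Beliefs for Receiving Agents).** Consider finitely many agents, divided into $S$ *sending* and $R$ *receiving* (nonempty) sub-networks, with a matrix $A=[a_{\ell k}]$ of combination weights, $a_{\ell k}\ge 0$, $\sum_\ell a_{\ell k}=1$, where $a_{\ell k}$ is the weight that agent $k$ gives to agent $\ell$. The network is *weakly connected*: numbering the sending agents first, $$A=\begin{bmatrix}T_{SS}&T_{SR}\\0&T_{RR}\end{bmatrix},$$ where $T_{SS}$ is block diagonal and $T_{RR}$ is block upper triangular with respect to the sub-networks; any two agents of the same sub-network are joined, in both directions, by a path inside that sub-network with nonzero weights; each sending sub-network has at least one agent with $a_{kk}>0$; and each receiving sub-network has at least one agent that gives a positive weight to an agent outside that sub-network. Let $\Theta$ be a finite set of states. Sending sub-network $s$ has true state $\theta^\circ_s\in\Theta$ and receiving sub-network $r$ has true state $\theta^\circ_r\in\Theta$ (these states need not be distinct). Agent $k$ has a finite signal space $Z_k$ and likelihoods $L_k(\cdot|\theta)$, which are probability mass functions on $Z_k$. At each time $i\ge 1$ it observes a random signal $\boldsymbol\xi_{k,i}$ with law $L_k(\cdot|\theta^\circ)$, where $\theta^\circ$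 is the true state of its sub-network. The families $(\boldsymbol\xi_{k,i})_k$, $i\ge1$, are independent over time (signals of different agents at the same time may be dependent). From prior probability distributions $\mu_{k,0}$ on $\Theta$, beliefs evolve by diffusion social learning: $$\boldsymbol\psi_{k,i}(\theta)=\frac{\boldsymbol\mu_{k,i-1}(\theta)L_k(\boldsymbol\xi_{k,i}|\theta)}{\sum_{\theta'\in\Theta}\boldsymbol\mu_{k,i-1}(\theta')L_k(\boldsymbol\xi_{k,i}|\theta')},\qquad \boldsymbol\mu_{k,i}(\theta)=\sum_{\ell}a_{\ell k}\boldsymbol\psi_{\ell,i}(\theta)$$ (a fraction with zero denominator is read as $0$). For an agent $k$ with true state $\theta^\circ$ let $\Theta_k=\{\theta\in\Theta: L_k(\zeta|\theta)=L_k(\zeta|\theta^\circ)\ \forall \zeta\in Z_k\}$ be its set of indistinguishable states. Assume that in each sending sub-network $s$: at least one agent has $\mu_{k,0}(\theta_s^\circ)>0$; each agent $k$ has a prevailing signal $\zeta_k^\circ\in Z_k$, that is, $L_k(\zeta^\circ_k|\theta^\circ_s)>L_k(\zeta^\circ_k|\theta)$ for all $\theta\in\Theta\setminus\Theta_k$;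 and $\bigcap_{k\in s}\Theta_k=\{\theta^\circ_s\}$. Assume moreover that $\theta_s^\circ\in\Theta_k$ for every receiving agent $k$ and every $s\in\{1,\dots,S\}$. Then $I-T_{RR}$ is invertible and, with $W=T_{SR}(I-T_{RR})^{-1}$ and with $\boldsymbol\mu_{\mathcal S,i}(\theta)$, $\boldsymbol\mu_{\mathcal R,i}(\theta)$ denoting the vectors of the beliefs at $\theta$ of all sending and of all receiving agents, almost surely, for every $\theta\in\Theta$, both limits below exist and $$\lim_{i\to\infty}\boldsymbol\mu_{\mathcal R,i}(\theta)=W^{\mathsf T}\Big(\lim_{i\to\infty}\boldsymbol\mu_{\mathcal S,i}(\theta)\Big),$$ where the limit for a sending agent of sub-network $s$ is $1$ if $\theta=\theta^\circ_s$ and $0$ otherwise. Consequently, for every receiving agent $k$, almost surely, for every $\theta\in\Theta$, $$\lim_{i\to\infty}\boldsymbol\mu_{k,i}(\theta)=q_k(\theta):=\sum_{s:\,\theta^\circ_s=\theta}\ \sum_{\ell\in s}[W^{\mathsf T}]_{k\ell},$$ and $q_k$ is a probability distribution on $\Theta$ supported on $\{\theta^\circ_1,\dots,\theta^\circ_S\}$.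 -/

import Mathlib

open MeasureTheory ProbabilityTheory Filter Topology
open scoped Matrix

namespace SocialLearning

/-! ### Weakly-connected networks

`A i j` is the weight with which agent `j` scales the data that arrives from agent `i`. -/

/-- Any two agents of the group `C` are joined, in both directions, by a path of edges with
nonzero weights that stays inside `C` (a single agent is joined to itself by the empty path). -/
def IsConnectedOn {K : Type*} (A : Matrix K K ℝ) (C : Set K) : Prop :=
  ∀ i ∈ C, ∀ j ∈ C, Relation.ReflTransGen (fun a b => a ∈ C ∧ b ∈ C ∧ 0 < A a b) i j

/-- The group `C` is connected and contains at least one agent with a self-loop. -/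
def IsStronglyConnectedOn {K : Type*} (A : Matrix K K ℝ) (C : Set K) : Prop :=
  IsConnectedOn A C ∧ ∃ k ∈ C, 0 < A k k

/-- A weakly-connected network. The sending agents `𝒮` are split by `netS` into `S` sub-networks,
the receiving agents `𝓡` are split by `netR` into `R` sub-networks. The combination matrix `A` has
the block form `[[T_SS, T_SR], [0, T_RR]]`, where `T_SS` is block diagonal and `T_RR` is block
upper triangular with respect to the sub-networks. -/
structure IsWeaklyConnected {𝒮 𝓡 : Type*} [Fintype 𝒮] [Fintype 𝓡] [DecidableEq 𝒮] [DecidableEq 𝓡]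
    {S R : ℕ} (netS : 𝒮 → Fin S) (netR : 𝓡 → Fin R) (A : Matrix (𝒮 ⊕ 𝓡) (𝒮 ⊕ 𝓡) ℝ) : Prop where
  /-- no sending sub-network is empty -/
  nonempty_send : Function.Surjective netS
  /-- no receiving sub-network is empty -/
  nonempty_recv : Function.Surjective netR
  /-- the weights are nonnegative and those used by any one agent add up to one -/
  leftStochastic : A ∈ Matrix.colStochastic ℝ (𝒮 ⊕ 𝓡)
  /-- no information flows from a receiving agent to a sending agent -/
  no_feedback : ∀ (k : 𝓡) (l : 𝒮), A (Sum.inr k) (Sum.inl l) = 0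
  /-- distinct sending sub-networks do not communicate -/
  send_separate : ∀ k l : 𝒮, netS k ≠ netS l → A (Sum.inl k) (Sum.inl l) = 0
  /-- no information flows from a receiving sub-network to one with a smaller index -/
  recv_triangular : ∀ k l : 𝓡, netR l < netR k → A (Sum.inr k) (Sum.inr l) = 0
  /-- each sending sub-network is strongly connected -/
  send_strong : ∀ s : Fin S, IsStronglyConnectedOn A (Sum.inl '' {k : 𝒮 | netS k = s})
  /-- each receiving sub-network is connected -/
  recv_connected : ∀ r : Fin R, IsConnectedOn A (Sum.inr '' {k : 𝓡 | netR k = r})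
  /-- each receiving sub-network does receive information from some other sub-network -/
  recv_influenced : ∀ r : Fin R, ∃ (k : 𝓡) (l : 𝒮 ⊕ 𝓡),
    netR k = r ∧ Sum.map netS netR l ≠ Sum.inr r ∧ 0 < A l (Sum.inr k)

/-- The matrix `W = T_SR (I - T_RR)⁻¹`. -/
noncomputable def influence {𝒮 𝓡 : Type*} [Fintype 𝓡] [DecidableEq 𝓡]
    (A : Matrix (𝒮 ⊕ 𝓡) (𝒮 ⊕ 𝓡) ℝ) : Matrix 𝒮 𝓡 ℝ :=
  A.toBlocks₁₂ * (1 - A.toBlocks₂₂)⁻¹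

/-- The weight at `θ` in the limit belief of the receiving agent `k`: the sum, over the sending
sub-networks `s` whose true state is `θ`, of the entries of the block `s` in row `k` of `Wᵀ`. -/
noncomputable def limitBelief {𝒮 𝓡 Θ : Type*} [Fintype 𝒮] [Fintype 𝓡] [DecidableEq 𝓡]
    [DecidableEq Θ] {S : ℕ} (netS : 𝒮 → Fin S) (A : Matrix (𝒮 ⊕ 𝓡) (𝒮 ⊕ 𝓡) ℝ)
    (θS : Fin S → Θ) (k : 𝓡) (θ : Θ) : ℝ :=
  ∑ s : Fin S with θS s = θ, ∑ l : 𝒮 with netS l = s, (influence A)ᵀ k l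

/-! ### Diffusion social learning -/

/-- `p` is a probability mass function on the finite set `α`. -/
def IsProbVec {α : Type*} [Fintype α] (p : α → ℝ) : Prop :=
  (∀ a, 0 ≤ p a) ∧ ∑ a, p a = 1

/-- The Bayesian update of the belief `μ` after the signal `ζ`, for the likelihood `L θ ζ`. -/
noncomputable def bayesUpdate {Θ Z : Type*} [Fintype Θ] (L : Θ → Z → ℝ) (μ : Θ → ℝ) (ζ : Z)
    (θ : Θ) : ℝ :=
  μ θ * L θ ζ / ∑ θ' : Θ, μ θ' * L θ' ζ

/-- The belief `μ_{k,i}(θ)` of agent `k` at time `i` produced by the diffusion strategy from the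
priors `μ₀` and the signals `x i k` observed by the agents `k` at the times `i ≥ 1`. -/
noncomputable def belief {K Θ : Type*} [Fintype K] [Fintype Θ] {Z : K → Type*}
    (A : Matrix K K ℝ) (L : ∀ k, Θ → Z k → ℝ) (μ₀ : K → Θ → ℝ) (x : ℕ → ∀ k, Z k) :
    ℕ → K → Θ → ℝ
  | 0 => μ₀
  | i + 1 => fun k θ =>
      ∑ l : K, A l k * bayesUpdate (L l) (belief A L μ₀ x i l) (x (i + 1) l) θ

/-- The set of the states that are indistinguishable from `θ₀` for an agent with likelihood `L`. -/
def indistinguishable {Θ Z : Type*} (L : Θ → Z → ℝ) (θ₀ : Θ) : Set Θ :=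
  {θ | ∀ ζ, L θ ζ = L θ₀ ζ}

/-- The signal `ζ` is prevailing for an agent with likelihood `L` and true state `θ₀`: it is more
likely under `θ₀` than under any state that the agent can distinguish from `θ₀`. -/
def IsPrevailing {Θ Z : Type*} (L : Θ → Z → ℝ) (θ₀ : Θ) (ζ : Z) : Prop :=
  ∀ θ, θ ∉ indistinguishable L θ₀ → L θ ζ < L θ₀ ζ

/-- The signals `ξ i` (the family of the signals of all agents at time `i`), `i ≥ 1`, are
independent over time, and the signal of agent `k` has the law `L k (θ₀ k)`, where `θ₀ k` is the
true state of agent `k`. Signals of different agents at the same time may be dependent. -/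
structure IsSignalProcess {Ω K Θ : Type*} [MeasurableSpace Ω] (P : Measure Ω) {Z : K → Type*}
    [∀ k, MeasurableSpace (Z k)] (L : ∀ k, Θ → Z k → ℝ) (θ₀ : K → Θ)
    (ξ : ℕ → Ω → ∀ k, Z k) : Prop where
  measurable : ∀ i, 1 ≤ i → Measurable (ξ i)
  indep : iIndepFun (fun i : ℕ => ξ (i + 1)) P
  law : ∀ i, 1 ≤ i → ∀ k ζ, P {ω | ξ i ω k = ζ} = ENNReal.ofReal (L k (θ₀ k) ζ)

end SocialLearning

/-! Give each agent a set of states: a sending agent its own true state, a receiving agent all true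
states of senders. Within this set the agent's likelihood is the true one. Call the belief missing
from the set stray; mass lost to zero denominators counts as stray too. If stray belief vanishes, a
Bayesian update hardly moves a belief (`abs_bayesUpdate_sub_le`), so the receiving beliefs obey a
linear recursion driven by the senders, up to vanishing errors. A maximum principle along paths from
the senders shows that `T_RR` contracts in a weighted norm, and the limit is the fixed point `Wᵀ` of
the senders' limits (`tendsto_belief_recv`). It remains to show that stray belief vanishes almost
surely.

Senders: let π be a positive fixed vector of `T_SS`. By Jensen, the π-weighted sum of -log of the
beliefs in the true states drops, in expectation, by at least a Hellinger error of the predicted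
signals (`logLoss_succ_le`, `hellingerSq_le`). Prevailing signals and connectivity bound the square
of the wrong belief by the errors of boundedly many consecutive steps (`sqControlled_linLoss`), so
it tends to zero. The same drift for the γ-th power of the loss makes the wrong belief to the power
1 + γ summable, for every γ in (0, 1] (`ae_summable_rpow_wrong_belief`).

Receivers: let Q be their weighted stray belief and ε that of the senders. The expected next Q is at
most F = ρQ + aε with ρ < 1, which alone gives no almost sure limit, as ε itself is not known to be
summable. But the next Q is also at most BF on every typical path, so the expected value of its
power 1 + γ is at most B^γ F^(1+γ). For small γ, B^γ ρ < 1 and convexity leaves a contraction plus a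
multiple of ε^(1+γ), which is summable (`ae_tendsto_recvStray`). -/

namespace SocialLearning

/-! ### The Bayesian update of a single agent -/

section Update

variable {Θ Z : Type*} [Fintype Θ] [Fintype Z] {L : Θ → Z → ℝ} {μ : Θ → ℝ}

/-- The probability of the signal `ζ` predicted by the belief `μ`. -/
noncomputable def evidence (L : Θ → Z → ℝ) (μ : Θ → ℝ) (ζ : Z) : ℝ := ∑ θ, μ θ * L θ ζ

omit [Fintype Z] in
lemma bayesUpdate_eq (L : Θ → Z → ℝ) (μ : Θ → ℝ) (ζ : Z) (θ : Θ) :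
    bayesUpdate L μ ζ θ = μ θ * L θ ζ / evidence L μ ζ := rfl

lemma IsProbVec.le_one {α : Type*} [Fintype α] {p : α → ℝ} (hp : IsProbVec p) (a : α) :
    p a ≤ 1 := by
  rw [← hp.2]
  exact Finset.single_le_sum (fun b _ => hp.1 b) (Finset.mem_univ a)

lemma evidence_nonneg (hL : ∀ θ, IsProbVec (L θ)) (hμ : ∀ θ, 0 ≤ μ θ) (ζ : Z) :
    0 ≤ evidence L μ ζ :=
  Finset.sum_nonneg fun θ _ => mul_nonneg (hμ θ) ((hL θ).1 ζ)

lemma mul_le_evidence (hL : ∀ θ, IsProbVec (L θ)) (hμ : ∀ θ, 0 ≤ μ θ) (ζ : Z) (θ : Θ) :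
    μ θ * L θ ζ ≤ evidence L μ ζ :=
  Finset.single_le_sum (f := fun θ => μ θ * L θ ζ)
    (fun θ _ => mul_nonneg (hμ θ) ((hL θ).1 ζ)) (Finset.mem_univ θ)

lemma sum_evidence (hL : ∀ θ, IsProbVec (L θ)) (μ : Θ → ℝ) :
    ∑ ζ, evidence L μ ζ = ∑ θ, μ θ := by
  simp only [evidence]
  rw [Finset.sum_comm]
  simp [← Finset.mul_sum, (hL _).2]

lemma evidence_le_one (hL : ∀ θ, IsProbVec (L θ)) (hμ : ∀ θ, 0 ≤ μ θ) (hμ1 : ∑ θ, μ θ ≤ 1)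
    (ζ : Z) : evidence L μ ζ ≤ 1 := by
  refine le_trans ?_ hμ1
  exact Finset.sum_le_sum fun θ _ => mul_le_of_le_one_right (hμ θ) ((hL θ).le_one ζ)

lemma bayesUpdate_nonneg (hL : ∀ θ, IsProbVec (L θ)) (hμ : ∀ θ, 0 ≤ μ θ) (ζ : Z) (θ : Θ) :
    0 ≤ bayesUpdate L μ ζ θ :=
  div_nonneg (mul_nonneg (hμ θ) ((hL θ).1 ζ)) (evidence_nonneg hL hμ ζ)

omit [Fintype Z] in
lemma sum_bayesUpdate (E : Finset Θ) (L : Θ → Z → ℝ) (μ : Θ → ℝ) (ζ : Z) :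
    ∑ θ ∈ E, bayesUpdate L μ ζ θ = (∑ θ ∈ E, μ θ * L θ ζ) / evidence L μ ζ := by
  simp [bayesUpdate_eq, Finset.sum_div]

omit [Fintype Z] in
lemma sum_bayesUpdate_eq_one {ζ : Z} (h : evidence L μ ζ ≠ 0) :
    ∑ θ, bayesUpdate L μ ζ θ = 1 := by
  rw [sum_bayesUpdate]
  exact div_self h

omit [Fintype Z] in
lemma sum_bayesUpdate_le_one (L : Θ → Z → ℝ) (μ : Θ → ℝ) (ζ : Z) :
    ∑ θ, bayesUpdate L μ ζ θ ≤ 1 := by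
  rw [sum_bayesUpdate]
  exact div_self_le_one _

lemma bayesUpdate_pos (hL : ∀ θ, IsProbVec (L θ)) (hμ : ∀ θ, 0 ≤ μ θ) {ζ : Z} {θ : Θ}
    (h : 0 < μ θ) (h' : 0 < L θ ζ) : 0 < bayesUpdate L μ ζ θ :=
  div_pos (mul_pos h h') ((mul_pos h h').trans_le (mul_le_evidence hL hμ ζ θ))

/-! ### Updates relative to a set `E` of states with common likelihood `L₀` -/

variable {E : Finset Θ} {L₀ : Z → ℝ}

omit [Fintype Θ] [Fintype Z] in
lemma sum_mul_of_mem (hE : ∀ θ ∈ E, ∀ ζ, L θ ζ = L₀ ζ) (ζ : Z) :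
    ∑ θ ∈ E, μ θ * L θ ζ = (∑ θ ∈ E, μ θ) * L₀ ζ := by
  rw [Finset.sum_mul]
  exact Finset.sum_congr rfl fun θ hθ => by rw [hE θ hθ]

lemma evidence_le_of_mem (hL : ∀ θ, IsProbVec (L θ)) (hμ : ∀ θ, 0 ≤ μ θ) (hμ1 : ∑ θ, μ θ ≤ 1)
    (hE : ∀ θ ∈ E, ∀ ζ, L θ ζ = L₀ ζ) (ζ : Z) :
    evidence L μ ζ ≤ (∑ θ ∈ E, μ θ) * L₀ ζ + (1 - ∑ θ ∈ E, μ θ) := by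
  classical
  have h1 := Finset.sum_add_sum_compl E fun θ => μ θ * L θ ζ
  have h2 := Finset.sum_add_sum_compl E μ
  have h3 : ∑ θ ∈ Eᶜ, μ θ * L θ ζ ≤ ∑ θ ∈ Eᶜ, μ θ :=
    Finset.sum_le_sum fun θ _ => mul_le_of_le_one_right (hμ θ) ((hL θ).le_one ζ)
  rw [sum_mul_of_mem hE] at h1
  simp only [evidence]
  linarith

lemma le_evidence_of_mem (hL : ∀ θ, IsProbVec (L θ)) (hμ : ∀ θ, 0 ≤ μ θ)
    (hE : ∀ θ ∈ E, ∀ ζ, L θ ζ = L₀ ζ) (ζ : Z) :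
    (∑ θ ∈ E, μ θ) * L₀ ζ ≤ evidence L μ ζ := by
  rw [← sum_mul_of_mem hE]
  exact Finset.sum_le_sum_of_subset_of_nonneg (Finset.subset_univ E)
    fun θ _ _ => mul_nonneg (hμ θ) ((hL θ).1 ζ)

omit [Fintype Z] in
lemma one_sub_sum_nonneg (hμ : ∀ θ, 0 ≤ μ θ) (hμ1 : ∑ θ, μ θ ≤ 1)
    (E : Finset Θ) : 0 ≤ 1 - ∑ θ ∈ E, μ θ := by
  have h := Finset.sum_le_sum_of_subset_of_nonneg (Finset.subset_univ E) fun θ _ _ => hμ θ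
  linarith

/-- One observation increases the belief in the complement of `E` by at most a constant factor. -/
lemma one_sub_sum_bayesUpdate_le (hL : ∀ θ, IsProbVec (L θ)) (hμ : ∀ θ, 0 ≤ μ θ)
    (hμ1 : ∑ θ, μ θ ≤ 1) (hE : ∀ θ ∈ E, ∀ ζ, L θ ζ = L₀ ζ) {ζ : Z} {c : ℝ} (hc : 0 < c)
    (hc1 : c ≤ 1) (hcζ : c ≤ L₀ ζ) :
    1 - ∑ θ ∈ E, bayesUpdate L μ ζ θ ≤ 2 / c * (1 - ∑ θ ∈ E, μ θ) := by
  have hu := one_sub_sum_nonneg hμ hμ1 E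
  have h2c : 2 ≤ 2 / c := by rw [le_div_iff₀ hc]; linarith
  have hnn : 0 ≤ ∑ θ ∈ E, bayesUpdate L μ ζ θ :=
    Finset.sum_nonneg fun θ _ => bayesUpdate_nonneg hL hμ ζ θ
  rw [sum_bayesUpdate, sum_mul_of_mem hE] at *
  set u := ∑ θ ∈ E, μ θ
  -- If `E` has at most half of the mass, the right side is at least 1. Otherwise the evidence is at
  -- least `c / 2`, which bounds the quotient.
  rcases le_or_gt u (1 / 2) with h | h
  · nlinarith
  · have hle := evidence_le_of_mem hL hμ hμ1 hE ζ
    have hge := le_evidence_of_mem hL hμ hE ζ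
    set m := evidence L μ ζ
    have hm : c / 2 ≤ m := by nlinarith
    have hm0 : 0 < m := by linarith
    have : 1 - u * L₀ ζ / m = (m - u * L₀ ζ) / m := by field_simp
    rw [this, div_le_iff₀ hm0]
    have : 2 / c * (1 - u) * (c / 2) = 1 - u := by field_simp
    have h5 : 2 / c * (1 - u) * (c / 2) ≤ 2 / c * (1 - u) * m :=
      mul_le_mul_of_nonneg_left hm (by positivity)
    linarith

/-- Outside `E` both the old and the new value lie between zero and the respective stray mass.
Inside `E` the update multiplies by `L₀ ζ / m`, where the evidence `m` differs from `L₀ ζ` only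
through the mass outside `E`. -/
lemma abs_bayesUpdate_sub_le (hL : ∀ θ, IsProbVec (L θ)) (hμ : ∀ θ, 0 ≤ μ θ)
    (hμ1 : ∑ θ, μ θ ≤ 1) (hE : ∀ θ ∈ E, ∀ ζ, L θ ζ = L₀ ζ) {ζ : Z} {c : ℝ} (hc : 0 < c)
    (hc1 : c ≤ 1) (hcζ : c ≤ L₀ ζ) (θ : Θ) :
    |bayesUpdate L μ ζ θ - μ θ| ≤ 2 / c * (1 - ∑ θ ∈ E, μ θ) := by
  classical
  have hu := one_sub_sum_nonneg hμ hμ1 E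
  have h2c : 2 ≤ 2 / c := by rw [le_div_iff₀ hc]; linarith
  have hnn := bayesUpdate_nonneg hL hμ ζ θ
  by_cases hθ : θ ∈ E
  · have hle := evidence_le_of_mem hL hμ hμ1 hE ζ
    have hge := le_evidence_of_mem hL hμ hE ζ
    have hθu : μ θ ≤ ∑ θ ∈ E, μ θ := Finset.single_le_sum (fun θ _ => hμ θ) hθ
    rw [bayesUpdate_eq, hE θ hθ] at *
    set u := ∑ θ ∈ E, μ θ
    set m := evidence L μ ζ
    rcases (hμ θ).eq_or_lt with h0 | h0
    · rw [← h0]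
      simp only [zero_mul, zero_div, sub_zero, abs_zero]
      positivity
    · have hL0 : 0 < L₀ ζ := hc.trans_le hcζ
      have hu0 : 0 < u := h0.trans_le hθu
      have hm0 : 0 < m := lt_of_lt_of_le (by positivity) hge
      have hr : 0 ≤ μ θ / m := by positivity
      have hr1 : μ θ * L₀ ζ / m ≤ μ θ / u := by
        rw [div_le_div_iff₀ hm0 hu0]; nlinarith
      have hr2 : μ θ / u ≤ 1 := (div_le_one hu0).2 hθu
      have e1 : μ θ / u - μ θ = μ θ / u * (1 - u) := by field_simp
      have e2 : μ θ - μ θ * L₀ ζ / m = μ θ / m * (m - L₀ ζ) := by field_simp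
      have hr3 : μ θ / m ≤ 1 / c := by
        rw [div_le_div_iff₀ hm0 hc]; nlinarith
      have hc' : 1 / c ≤ 2 / c := by gcongr; norm_num
      rw [abs_le]
      constructor
      · have h1 : m - L₀ ζ ≤ 1 - u := by nlinarith
        have h2 : μ θ / m * (m - L₀ ζ) ≤ μ θ / m * (1 - u) := mul_le_mul_of_nonneg_left h1 hr
        have h3 : μ θ / m * (1 - u) ≤ 2 / c * (1 - u) :=
          mul_le_mul_of_nonneg_right (hr3.trans hc') hu
        linarith
      · nlinarith
  · have h1 := one_sub_sum_bayesUpdate_le hL hμ hμ1 hE hc hc1 hcζ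
    have h2 := sum_bayesUpdate_le_one L μ ζ
    have h3 : bayesUpdate L μ ζ θ + ∑ θ ∈ E, bayesUpdate L μ ζ θ ≤
        ∑ θ, bayesUpdate L μ ζ θ := by
      rw [← Finset.sum_insert hθ]
      exact Finset.sum_le_sum_of_subset_of_nonneg (Finset.subset_univ _)
        fun θ _ _ => bayesUpdate_nonneg hL hμ ζ θ
    have h4 : μ θ + ∑ θ ∈ E, μ θ ≤ ∑ θ, μ θ := by
      rw [← Finset.sum_insert hθ]
      exact Finset.sum_le_sum_of_subset_of_nonneg (Finset.subset_univ _) fun θ _ _ => hμ θ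
    have := hμ θ
    rw [abs_le]
    constructor <;> nlinarith

/-- Under the law `L₀`, the expected belief in the complement of `E` does not increase. -/
lemma sum_mul_one_sub_bayesUpdate_le (hL : ∀ θ, IsProbVec (L θ)) (hμ : ∀ θ, 0 ≤ μ θ)
    (hμ1 : ∑ θ, μ θ ≤ 1) (hE : ∀ θ ∈ E, ∀ ζ, L θ ζ = L₀ ζ) (hL₀ : IsProbVec L₀) :
    ∑ ζ, L₀ ζ * (1 - ∑ θ ∈ E, bayesUpdate L μ ζ θ) ≤ 1 - ∑ θ ∈ E, μ θ := by
  have hu : 0 ≤ ∑ θ ∈ E, μ θ := Finset.sum_nonneg fun θ _ => hμ θ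
  -- The tangent bound `L₀² / m ≥ 2 L₀ - m` removes the evidence `m` from the denominator; the
  -- result is linear in `m`, whose sum over the signals is at most one.
  have key : ∀ ζ, L₀ ζ * (1 - ∑ θ ∈ E, bayesUpdate L μ ζ θ) ≤
      L₀ ζ - (∑ θ ∈ E, μ θ) * (2 * L₀ ζ - evidence L μ ζ) := by
    intro ζ
    have hge := le_evidence_of_mem hL hμ hE ζ
    have hm := evidence_nonneg hL hμ ζ
    have hL0 := hL₀.1 ζ
    rw [sum_bayesUpdate, sum_mul_of_mem hE]
    set u := ∑ θ ∈ E, μ θ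
    set m := evidence L μ ζ
    rcases hm.eq_or_lt with h0 | h0
    · rw [← h0] at hge ⊢
      have : u * L₀ ζ = 0 := le_antisymm hge (by positivity)
      simp only [div_zero]
      nlinarith
    · have : L₀ ζ * (1 - u * L₀ ζ / m) - (L₀ ζ - u * (2 * L₀ ζ - m)) =
          - (u * (L₀ ζ - m) ^ 2 / m) := by field_simp; ring
      have : 0 ≤ u * (L₀ ζ - m) ^ 2 / m := by positivity
      linarith
  refine (Finset.sum_le_sum fun ζ _ => key ζ).trans ?_
  rw [Finset.sum_sub_distrib, ← Finset.mul_sum, Finset.sum_sub_distrib, ← Finset.mul_sum, hL₀.2,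
    sum_evidence hL]
  nlinarith

/-- The squared Hellinger distance (without the usual factor) of two functions. -/
noncomputable def hellingerSq (p q : Z → ℝ) : ℝ := ∑ ζ, (√(p ζ) - √(q ζ)) ^ 2

lemma hellingerSq_nonneg (p q : Z → ℝ) : 0 ≤ hellingerSq p q :=
  Finset.sum_nonneg fun _ _ => sq_nonneg _

/-- Each summand on the right equals `(√p - √q)² + (p - q)`, and the differences `p - q` have
nonnegative sum because `q` has mass at most one. The right side is the expected decrease found in
`logLoss_succ_le`. -/
lemma hellingerSq_le {p q : Z → ℝ} (hp : ∀ ζ, 0 ≤ p ζ) (hp1 : ∑ ζ, p ζ = 1) (hq : ∀ ζ, 0 ≤ q ζ)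
    (hq1 : ∑ ζ, q ζ ≤ 1) : hellingerSq p q ≤ ∑ ζ, p ζ * (2 * (1 - √(q ζ / p ζ))) := by
  have key : ∀ ζ, p ζ * (2 * (1 - √(q ζ / p ζ))) = (√(p ζ) - √(q ζ)) ^ 2 + (p ζ - q ζ) := by
    intro ζ
    have h1 := Real.sq_sqrt (hp ζ)
    have h2 := Real.sq_sqrt (hq ζ)
    have h3 : p ζ * √(q ζ / p ζ) = √(p ζ) * √(q ζ) := by
      rw [Real.sqrt_div (hq ζ)]
      rcases (hp ζ).eq_or_lt with h | h
      · simp [← h]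
      · have := Real.sqrt_pos.2 h
        field_simp
        rw [h1, mul_comm]
    nlinarith
  simp only [key, Finset.sum_add_distrib, Finset.sum_sub_distrib, hp1]
  simp only [hellingerSq]
  linarith

lemma sub_sq_le_hellingerSq {p q : Z → ℝ} (hp : ∀ ζ, 0 ≤ p ζ) (hp1 : ∀ ζ, p ζ ≤ 1)
    (hq : ∀ ζ, 0 ≤ q ζ) (hq1 : ∀ ζ, q ζ ≤ 1) (ζ : Z) :
    (p ζ - q ζ) ^ 2 ≤ 4 * hellingerSq p q := by
  have h1 : (√(p ζ) - √(q ζ)) ^ 2 ≤ hellingerSq p q :=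
    Finset.single_le_sum (f := fun ζ => (√(p ζ) - √(q ζ)) ^ 2) (fun _ _ => sq_nonneg _)
      (Finset.mem_univ ζ)
  have h2 : p ζ - q ζ = (√(p ζ) - √(q ζ)) * (√(p ζ) + √(q ζ)) := by
    nlinarith [Real.sq_sqrt (hp ζ), Real.sq_sqrt (hq ζ)]
  have h3 : √(p ζ) ≤ 1 := Real.sqrt_le_one.2 (hp1 ζ)
  have h4 : √(q ζ) ≤ 1 := Real.sqrt_le_one.2 (hq1 ζ)
  have h5 := Real.sqrt_nonneg (p ζ)
  have h6 := Real.sqrt_nonneg (q ζ)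
  have h7 : (√(p ζ) + √(q ζ)) ^ 2 ≤ 4 := by nlinarith
  rw [h2, mul_pow]
  nlinarith [sq_nonneg (√(p ζ) - √(q ζ))]

/-- A prevailing signal bounds the belief in the distinguishable states by the error of the
prediction. -/
lemma exists_sq_le_hellingerSq (hL : ∀ θ, IsProbVec (L θ)) {θ₀ : Θ} {ζ : Z}
    (hζ : IsPrevailing L θ₀ ζ) {θ : Θ} (hθ : θ ∉ indistinguishable L θ₀) :
    ∃ C > 0, ∀ μ : Θ → ℝ, (∀ θ, 0 ≤ μ θ) → ∑ θ, μ θ = 1 →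
      μ θ ^ 2 ≤ C * hellingerSq (L θ₀) (evidence L μ) := by
  have hd : 0 < L θ₀ ζ - L θ ζ := sub_pos.2 (hζ θ hθ)
  refine ⟨4 / (L θ₀ ζ - L θ ζ) ^ 2, by positivity, fun μ hμ hμ1 => ?_⟩
  have h1 := sub_sq_le_hellingerSq (hL θ₀).1 (hL θ₀).le_one (evidence_nonneg hL hμ)
    (evidence_le_one hL hμ hμ1.le) ζ
  -- At a prevailing signal all gaps `L θ₀ ζ - L θ' ζ` are nonnegative, so errors of different
  -- states cannot cancel.
  have h2 : μ θ * (L θ₀ ζ - L θ ζ) ≤ L θ₀ ζ - evidence L μ ζ := by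
    have e : L θ₀ ζ - evidence L μ ζ = ∑ θ', μ θ' * (L θ₀ ζ - L θ' ζ) := by
      simp only [mul_sub, Finset.sum_sub_distrib, ← Finset.sum_mul, hμ1, one_mul, evidence]
    rw [e]
    refine Finset.single_le_sum (f := fun θ' => μ θ' * (L θ₀ ζ - L θ' ζ)) (fun θ' _ => ?_)
      (Finset.mem_univ θ)
    refine mul_nonneg (hμ θ') ?_
    by_cases h : θ' ∈ indistinguishable L θ₀
    · rw [h ζ, sub_self]
    · exact (sub_pos.2 (hζ θ' h)).le
  have h3 : (μ θ * (L θ₀ ζ - L θ ζ)) ^ 2 ≤ (L θ₀ ζ - evidence L μ ζ) ^ 2 :=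
    pow_le_pow_left₀ (mul_nonneg (hμ θ) hd.le) h2 2
  rw [div_mul_eq_mul_div, le_div_iff₀ (by positivity), ← mul_pow]
  exact h3.trans h1

end Update

/-! ### Elementary properties of the beliefs -/

section Belief

variable {K Θ : Type*} [Fintype K] [Fintype Θ] {Z : K → Type*} [∀ k, Fintype (Z k)]
  {A : Matrix K K ℝ} {L : ∀ k, Θ → Z k → ℝ} {μ₀ : K → Θ → ℝ}

omit [∀ k, Fintype (Z k)] in
lemma belief_succ (A : Matrix K K ℝ) (L : ∀ k, Θ → Z k → ℝ) (μ₀ : K → Θ → ℝ) (x : ℕ → ∀ k, Z k)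
    (i : ℕ) (k : K) (θ : Θ) : belief A L μ₀ x (i + 1) k θ =
      ∑ l : K, A l k * bayesUpdate (L l) (belief A L μ₀ x i l) (x (i + 1) l) θ := rfl

omit [∀ k, Fintype (Z k)] in
-- Adaptedness, stated pathwise; it plays the role of a filtration. The window starts at 1 because
-- the signal at time 0 is never used.
lemma belief_dependsOn (A : Matrix K K ℝ) (L : ∀ k, Θ → Z k → ℝ) (μ₀ : K → Θ → ℝ) {i n : ℕ}
    (h : i ≤ n) : DependsOn (fun x => belief A L μ₀ x i) (Set.Icc 1 n) := by
  intro x y hxy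
  induction i with
  | zero => rfl
  | succ i ih =>
    funext k θ
    have := ih (by omega)
    simp only at this
    simp only [belief_succ, this, hxy (i + 1) ⟨by omega, h⟩]

variable [DecidableEq K]

lemma belief_nonneg (hA : A ∈ Matrix.colStochastic ℝ K) (hL : ∀ k θ, IsProbVec (L k θ))
    (hμ₀ : ∀ k, IsProbVec (μ₀ k)) (x : ℕ → ∀ k, Z k) (i : ℕ) (k : K) (θ : Θ) :
    0 ≤ belief A L μ₀ x i k θ := by
  induction i generalizing k θ with
  | zero => exact (hμ₀ k).1 θ
  | succ i ih =>
    exact Finset.sum_nonneg fun l _ => mul_nonneg (Matrix.nonneg_of_mem_colStochastic hA)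
      (bayesUpdate_nonneg (hL l) (ih l) _ _)

omit [∀ k, Fintype (Z k)] [DecidableEq K] in
lemma sum_belief_succ (x : ℕ → ∀ k, Z k) (i : ℕ) (k : K) (E : Finset Θ) :
    ∑ θ ∈ E, belief A L μ₀ x (i + 1) k θ =
      ∑ l, A l k * ∑ θ ∈ E, bayesUpdate (L l) (belief A L μ₀ x i l) (x (i + 1) l) θ := by
  simp only [belief_succ, Finset.mul_sum]
  exact Finset.sum_comm

omit [∀ k, Fintype (Z k)] in
lemma one_sub_sum_belief_succ (hA : A ∈ Matrix.colStochastic ℝ K) (x : ℕ → ∀ k, Z k) (i : ℕ)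
    (k : K) (E : Finset Θ) :
    1 - ∑ θ ∈ E, belief A L μ₀ x (i + 1) k θ = ∑ l, A l k *
      (1 - ∑ θ ∈ E, bayesUpdate (L l) (belief A L μ₀ x i l) (x (i + 1) l) θ) := by
  simp only [sum_belief_succ, mul_sub, mul_one, Finset.sum_sub_distrib,
    Matrix.sum_col_of_mem_colStochastic hA]

omit [∀ k, Fintype (Z k)] in
lemma sum_belief_le_one (hA : A ∈ Matrix.colStochastic ℝ K)
    (hμ₀ : ∀ k, IsProbVec (μ₀ k)) (x : ℕ → ∀ k, Z k) (i : ℕ) (k : K) :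
    ∑ θ, belief A L μ₀ x i k θ ≤ 1 := by
  cases i with
  | zero => exact (hμ₀ k).2.le
  | succ i =>
    rw [← sub_nonneg, one_sub_sum_belief_succ hA]
    exact Finset.sum_nonneg fun l _ => mul_nonneg (Matrix.nonneg_of_mem_colStochastic hA)
      (sub_nonneg.2 (sum_bayesUpdate_le_one _ _ _))

lemma belief_le_one (hA : A ∈ Matrix.colStochastic ℝ K) (hL : ∀ k θ, IsProbVec (L k θ))
    (hμ₀ : ∀ k, IsProbVec (μ₀ k)) (x : ℕ → ∀ k, Z k) (i : ℕ) (k : K) (θ : Θ) :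
    belief A L μ₀ x i k θ ≤ 1 :=
  (Finset.single_le_sum (fun θ _ => belief_nonneg hA hL hμ₀ x i k θ) (Finset.mem_univ θ)).trans
    (sum_belief_le_one hA hμ₀ x i k)

/-- Every signal of the path `x` has positive probability under the true states. -/
def IsTypical (L : ∀ k, Θ → Z k → ℝ) (θ₀ : K → Θ) (x : ℕ → ∀ k, Z k) : Prop :=
  ∀ i, 1 ≤ i → ∀ k, 0 < L k (θ₀ k) (x i k)

omit [Fintype Θ] [DecidableEq K] in
lemma exists_lower_bound (L : ∀ k, Θ → Z k → ℝ) (θ₀ : K → Θ) :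
    ∃ c, 0 < c ∧ c ≤ 1 ∧ ∀ k ζ, 0 < L k (θ₀ k) ζ → c ≤ L k (θ₀ k) ζ := by
  classical
  -- The extra element 1 makes the set nonempty and forces the minimum to be at most one.
  let s : Finset ℝ := insert 1
    ((Finset.univ.image fun p : Σ k, Z k => L p.1 (θ₀ p.1) p.2).filter (0 < ·))
  have hs : s.Nonempty := ⟨1, by simp [s]⟩
  refine ⟨s.min' hs, ?_, s.min'_le 1 (by simp [s]), fun k ζ h => s.min'_le _ ?_⟩
  · rw [Finset.lt_min'_iff]
    intro y hy
    simp only [s, Finset.mem_insert, Finset.mem_filter] at hy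
    rcases hy with rfl | hy
    · norm_num
    · exact hy.2
  · simp only [s, Finset.mem_insert, Finset.mem_filter, Finset.mem_image, Finset.mem_univ,
      true_and]
    exact Or.inr ⟨⟨⟨k, ζ⟩, rfl⟩, h⟩

end Belief

/-! ### Functionals of the signals -/

section Probability

/-- The integral of the sum is the sum of the integrals, hence finite, so the sum is finite almost
everywhere. -/
lemma ae_summable_of_sum_integral_le {Ω : Type*} [MeasurableSpace Ω] {P : Measure Ω}
    {f : ℕ → Ω → ℝ} (hf : ∀ i, Integrable (f i) P) (h0 : ∀ i, 0 ≤ᵐ[P] f i) {C : ℝ}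
    (hC : ∀ n, ∑ i ∈ Finset.range n, ∫ ω, f i ω ∂P ≤ C) :
    ∀ᵐ ω ∂P, Summable fun i => f i ω := by
  have hs : Summable fun i => ∫ ω, f i ω ∂P :=
    summable_of_sum_range_le (fun i => integral_nonneg_of_ae (h0 i)) hC
  have hlt : ∫⁻ ω, ∑' i, ENNReal.ofReal (f i ω) ∂P ≠ ⊤ := by
    rw [lintegral_tsum fun i => (hf i).aemeasurable.ennreal_ofReal]
    simp_rw [← ofReal_integral_eq_lintegral_ofReal (hf _) (h0 _)]
    exact hs.tsum_ofReal_ne_top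
  have hae := ae_lt_top' (AEMeasurable.tsum fun i => (hf i).aemeasurable.ennreal_ofReal) hlt
  filter_upwards [hae, ae_all_iff.2 h0] with ω h1 h2
  have h3 := ENNReal.summable_toReal h1.ne
  refine h3.congr fun i => ?_
  exact ENNReal.toReal_ofReal (h2 i)

variable {Ω K Θ : Type*} [Fintype K] [MeasurableSpace Ω] {P : Measure Ω} [IsProbabilityMeasure P]
  {Z : K → Type*} [∀ k, Fintype (Z k)] [∀ k, MeasurableSpace (Z k)]
  [∀ k, MeasurableSingletonClass (Z k)] {L : ∀ k, Θ → Z k → ℝ} {θ₀ : K → Θ}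
  {ξ : ℕ → Ω → ∀ k, Z k}

omit [IsProbabilityMeasure P] [∀ k, MeasurableSingletonClass (Z k)] in
lemma IsSignalProcess.ae_isTypical (hξ : IsSignalProcess P L θ₀ ξ) :
    ∀ᵐ ω ∂P, IsTypical L θ₀ fun j => ξ j ω := by
  have h : ∀ i k ζ, ∀ᵐ ω ∂P, 1 ≤ i → ξ i ω k = ζ → 0 < L k (θ₀ k) ζ := by
    intro i k ζ
    by_cases hi : 1 ≤ i
    · by_cases hζ : 0 < L k (θ₀ k) ζ
      · exact ae_of_all _ fun _ _ _ => hζ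
      · have h0 : P {ω | ξ i ω k = ζ} = 0 := by
          rw [hξ.law i hi k ζ, ENNReal.ofReal_eq_zero]
          exact not_lt.1 hζ
        have : ∀ᵐ ω ∂P, ¬ ξ i ω k = ζ := by
          rw [ae_iff]
          simpa using h0
        filter_upwards [this] with ω hω _ h using absurd h hω
    · exact ae_of_all _ fun _ h => absurd h hi
  have h' : ∀ᵐ ω ∂P, ∀ i k ζ, 1 ≤ i → ξ i ω k = ζ → 0 < L k (θ₀ k) ζ :=
    ae_all_iff.2 fun i => ae_all_iff.2 fun k => ae_all_iff.2 fun ζ => h i k ζ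
  filter_upwards [h'] with ω hω i hi k using hω i k _ hi rfl

omit [Fintype K] [∀ k, Fintype (Z k)] [∀ k, MeasurableSpace (Z k)]
  [∀ k, MeasurableSingletonClass (Z k)] in
/-- A functional of the signals up to time `i` factors through the finite history. -/
lemma exists_history_factor (P : Measure Ω) [IsProbabilityMeasure P] (ξ : ℕ → Ω → ∀ k, Z k)
    {i : ℕ} {F : (ℕ → ∀ k, Z k) → ℝ} (hF : DependsOn F (Set.Icc 1 i)) :
    ∃ G : (∀ _ : Finset.range i, ∀ k, Z k) → ℝ,
      ∀ ω, F (fun j => ξ j ω) = G fun j => ξ (j + 1) ω := by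
  -- The value at `ω₀` only fills the times outside `1, …, i`, on which `F` does not depend.
  obtain ⟨ω₀⟩ : Nonempty Ω := P.nonempty_of_neZero
  refine ⟨fun r => F fun j => if h : j - 1 ∈ Finset.range i then r ⟨j - 1, h⟩ else ξ 0 ω₀,
    fun ω => hF fun j hj => ?_⟩
  have h1 : j - 1 ∈ Finset.range i := by
    have := hj.1; have := hj.2
    rw [Finset.mem_range]; omega
  simp only [dif_pos h1]
  rw [Nat.sub_add_cancel hj.1]

omit [Fintype K] [IsProbabilityMeasure P] [∀ k, Fintype (Z k)]
  [∀ k, MeasurableSingletonClass (Z k)] in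
lemma IsSignalProcess.measurable_history (hξ : IsSignalProcess P L θ₀ ξ) (i : ℕ) :
    Measurable fun ω => (fun j : Finset.range i => ξ (j + 1) ω) :=
  measurable_pi_lambda _ fun j => hξ.measurable _ (by omega)

/-- A history of bounded length takes finitely many values, so every function of it is measurable
and integrable. -/
lemma IsSignalProcess.integrable (hξ : IsSignalProcess P L θ₀ ξ)
    {i : ℕ} {F : (ℕ → ∀ k, Z k) → ℝ} (hF : DependsOn F (Set.Icc 1 i)) :
    Integrable (fun ω => F fun j => ξ j ω) P := by
  obtain ⟨G, hG⟩ := exists_history_factor P ξ hF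
  simp only [hG]
  have hm := hξ.measurable_history i
  have := Measure.isProbabilityMeasure_map (μ := P) hm.aemeasurable
  exact (Integrable.of_finite (f := G)
    (μ := P.map fun ω => (fun j : Finset.range i => ξ (j + 1) ω))).comp_measurable hm

/-- Split according to the value of the next signal: each indicator is independent of the history.
`F` may see the next signal of one agent only, since the joint law across agents is unknown. -/
lemma IsSignalProcess.integral_next (hξ : IsSignalProcess P L θ₀ ξ)
    (hL : ∀ k θ, IsProbVec (L k θ)) {i : ℕ} {k : K} {F : Z k → (ℕ → ∀ k, Z k) → ℝ}
    (hF : ∀ ζ, DependsOn (F ζ) (Set.Icc 1 i)) :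
    Integrable (fun ω => F (ξ (i + 1) ω k) fun j => ξ j ω) P ∧
    ∫ ω, F (ξ (i + 1) ω k) (fun j => ξ j ω) ∂P =
      ∫ ω, ∑ ζ, L k (θ₀ k) ζ * F ζ (fun j => ξ j ω) ∂P := by
  classical
  have hmeas : Measurable fun ω => ξ (i + 1) ω k :=
    (measurable_pi_apply k).comp (hξ.measurable _ (by omega))
  have hset : ∀ ζ, MeasurableSet {ω | ξ (i + 1) ω k = ζ} := fun ζ =>
    hmeas (measurableSet_singleton ζ)
  have heq : ∀ ω, F (ξ (i + 1) ω k) (fun j => ξ j ω) =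
      ∑ ζ, (if ξ (i + 1) ω k = ζ then (1 : ℝ) else 0) * F ζ (fun j => ξ j ω) := by
    intro ω
    simp [ite_mul]
  have hdep : ∀ ζ, DependsOn (fun x : ℕ → ∀ k, Z k =>
      (if x (i + 1) k = ζ then (1 : ℝ) else 0) * F ζ x) (Set.Icc 1 (i + 1)) := by
    intro ζ x y hxy
    simp only [hxy (i + 1) ⟨by omega, le_rfl⟩]
    rw [hF ζ fun j hj => hxy j ⟨hj.1, hj.2.trans (by omega)⟩]
  have hint : ∀ ζ, Integrable (fun ω => (if ξ (i + 1) ω k = ζ then (1 : ℝ) else 0) *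
      F ζ fun j => ξ j ω) P := fun ζ => hξ.integrable (hdep ζ)
  have hprod : ∀ ζ, ∫ ω, (if ξ (i + 1) ω k = ζ then (1 : ℝ) else 0) * F ζ (fun j => ξ j ω) ∂P =
      L k (θ₀ k) ζ * ∫ ω, F ζ (fun j => ξ j ω) ∂P := by
    intro ζ
    obtain ⟨G, hG⟩ := exists_history_factor P ξ (hF ζ)
    have hind := hξ.indep.indepFun_finset {i} (Finset.range i) (by simp)
      fun j => hξ.measurable _ (by omega)
    have hind' := hind.comp (φ := fun r => if r ⟨i, by simp⟩ k = ζ then (1 : ℝ) else 0) (ψ := G)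
      (measurable_of_finite _) (measurable_of_finite _)
    have h1 : Integrable (fun ω => if ξ (i + 1) ω k = ζ then (1 : ℝ) else 0) P := by
      refine hξ.integrable (F := fun x => if x (i + 1) k = ζ then (1 : ℝ) else 0)
        (i := i + 1) ?_
      intro x y hxy
      simp only [hxy (i + 1) ⟨by omega, le_rfl⟩]
    have h2 := hξ.integrable (hF ζ)
    have h3 : ∫ ω, (if ξ (i + 1) ω k = ζ then (1 : ℝ) else 0) ∂P = L k (θ₀ k) ζ := by
      have : (fun ω => if ξ (i + 1) ω k = ζ then (1 : ℝ) else 0) =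
          Set.indicator {ω | ξ (i + 1) ω k = ζ} 1 := by
        funext ω
        simp [Set.indicator_apply]
      rw [this, integral_indicator_one (hset ζ), measureReal_def, hξ.law _ (by omega),
        ENNReal.toReal_ofReal ((hL _ _).1 _)]
    simp only [hG] at h2 ⊢
    rw [← h3]
    exact hind'.integral_fun_mul_eq_mul_integral h1.aestronglyMeasurable h2.aestronglyMeasurable
  simp only [heq]
  refine ⟨integrable_finsetSum _ fun ζ _ => hint ζ, ?_⟩
  rw [integral_finsetSum _ fun ζ _ => hint ζ, integral_finsetSum _ fun ζ _ =>
    (hξ.integrable (hF ζ)).const_mul _]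
  exact Finset.sum_congr rfl fun ζ _ => by rw [hprod ζ, integral_const_mul]

/-- A nonnegative adapted process whose expected decrease is at least `D i` has almost surely
summable decreases `D i`. The bound on the next value splits into contributions of the agents,
because only the marginal laws of the signals are known. -/
lemma IsSignalProcess.ae_summable_of_drift (hξ : IsSignalProcess P L θ₀ ξ)
    (hL : ∀ k θ, IsProbVec (L k θ)) (N : ℕ) {Y C D : ℕ → (ℕ → ∀ k, Z k) → ℝ}
    {H : ℕ → ∀ k, Z k → (ℕ → ∀ k, Z k) → ℝ}
    (hYd : ∀ i, DependsOn (Y i) (Set.Icc 1 i)) (hCd : ∀ i, DependsOn (C i) (Set.Icc 1 i))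
    (hDd : ∀ i, DependsOn (D i) (Set.Icc 1 i))
    (hHd : ∀ i k ζ, DependsOn (H i k ζ) (Set.Icc 1 i))
    (hY : ∀ x, IsTypical L θ₀ x → ∀ i, N ≤ i → 0 ≤ Y i x)
    (hD : ∀ x, IsTypical L θ₀ x → ∀ i, N ≤ i → 0 ≤ D i x)
    (hstep : ∀ x, IsTypical L θ₀ x → ∀ i, N ≤ i →
      Y (i + 1) x ≤ C i x + ∑ k, H i k (x (i + 1) k) x)
    (hdrift : ∀ x, IsTypical L θ₀ x → ∀ i, N ≤ i →
      C i x + ∑ k, ∑ ζ, L k (θ₀ k) ζ * H i k ζ x ≤ Y i x - D i x) :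
    ∀ᵐ ω ∂P, Summable fun i => D i fun j => ξ j ω := by
  have htyp := hξ.ae_isTypical
  have hle : ∀ i, N ≤ i → ∫ ω, D i (fun j => ξ j ω) ∂P ≤
      ∫ ω, Y i (fun j => ξ j ω) ∂P - ∫ ω, Y (i + 1) (fun j => ξ j ω) ∂P := by
    intro i hi
    have hCi := hξ.integrable (hCd i)
    have hHi := fun k => hξ.integral_next hL (hHd i k)
    have hHsum : ∀ k, Integrable (fun ω => ∑ ζ, L k (θ₀ k) ζ * H i k ζ fun j => ξ j ω) P :=
      fun k => integrable_finsetSum _ fun ζ _ => (hξ.integrable (hHd i k ζ)).const_mul _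
    have h1 : ∫ ω, Y (i + 1) (fun j => ξ j ω) ∂P ≤
        ∫ ω, (C i (fun j => ξ j ω) + ∑ k, H i k (ξ (i + 1) ω k) fun j => ξ j ω) ∂P := by
      refine integral_mono_ae (hξ.integrable (hYd _))
        (hCi.add (integrable_finsetSum _ fun k _ => (hHi k).1)) ?_
      filter_upwards [htyp] with ω hω using hstep _ hω i hi
    have h2 : ∫ ω, (C i (fun j => ξ j ω) + ∑ k, ∑ ζ, L k (θ₀ k) ζ * H i k ζ fun j => ξ j ω) ∂P ≤
        ∫ ω, (Y i (fun j => ξ j ω) - D i fun j => ξ j ω) ∂P := by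
      refine integral_mono_ae (hCi.add (integrable_finsetSum _ fun k _ => hHsum k))
        ((hξ.integrable (hYd _)).sub (hξ.integrable (hDd _))) ?_
      filter_upwards [htyp] with ω hω using hdrift _ hω i hi
    rw [integral_add hCi (integrable_finsetSum _ fun k _ => (hHi k).1),
      integral_finsetSum _ fun k _ => (hHi k).1, Finset.sum_congr rfl fun k _ => (hHi k).2] at h1
    rw [integral_add hCi (integrable_finsetSum _ fun k _ => hHsum k),
      integral_finsetSum _ fun k _ => hHsum k,
      integral_sub (hξ.integrable (hYd _)) (hξ.integrable (hDd _))] at h2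
    linarith
  -- The expected decreases telescope, and `Y` stays nonnegative from time `N` on, so they sum to at
  -- most the expectation of `Y N`.
  have hsum : ∀ n, ∑ i ∈ Finset.range n, ∫ ω, D (i + N) (fun j => ξ j ω) ∂P ≤
      ∫ ω, Y N (fun j => ξ j ω) ∂P - ∫ ω, Y (n + N) (fun j => ξ j ω) ∂P := by
    intro n
    induction n with
    | zero => simp
    | succ n ih =>
      rw [Finset.sum_range_succ]
      have := hle (n + N) (by omega)
      rw [show n + 1 + N = n + N + 1 by ring]
      linarith
  have := ae_summable_of_sum_integral_le (P := P) (f := fun i ω => D (i + N) fun j => ξ j ω)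
    (C := ∫ ω, Y N (fun j => ξ j ω) ∂P) (fun i => hξ.integrable (hDd _))
    (fun i => by filter_upwards [htyp] with ω hω using hD _ hω _ (by omega))
    (fun n => (hsum n).trans (by
      have : 0 ≤ ∫ ω, Y (n + N) (fun j => ξ j ω) ∂P := integral_nonneg_of_ae (by
        filter_upwards [htyp] with ω hω using hY _ hω _ (by omega))
      linarith))
  filter_upwards [this] with ω hω
  exact (summable_nat_add_iff N).1 hω

end Probability

/-! ### Combination matrices -/

section Network

/-- A left-stochastic matrix whose columns in `C` are supported in the connected group `C` has a
fixed nonnegative vector that is supported in `C` and positive on `C`. -/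
lemma exists_fixed_vector_of_connected {K : Type*} [Fintype K] [DecidableEq K] {T : Matrix K K ℝ}
    (hT : T ∈ Matrix.colStochastic ℝ K) (C : Set K) (hne : C.Nonempty)
    (hclosed : ∀ k ∈ C, ∀ l ∉ C, T l k = 0)
    (hconn : ∀ k ∈ C, ∀ l ∈ C, Relation.ReflTransGen (fun a b => 0 < T a b) k l) :
    ∃ π : K → ℝ, (∀ k, 0 ≤ π k) ∧ (∀ k ∈ C, 0 < π k) ∧ ∀ l, ∑ k, T l k * π k = π l := by
  classical
  have hnn : ∀ l k, 0 ≤ T l k := fun l k => Matrix.nonneg_of_mem_colStochastic hT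
  -- With the columns outside `C` erased, the indicator of `C` is a left fixed vector; hence `1 - M`
  -- is singular and also has a right null vector, which must live on `C`.
  let M : Matrix K K ℝ := fun l k => if k ∈ C then T l k else 0
  have hleft : (fun k => if k ∈ C then (1 : ℝ) else 0) ᵥ* (1 - M) = 0 := by
    funext k
    rw [Matrix.vecMul_sub, Matrix.vecMul_one]
    simp only [Pi.sub_apply, Matrix.vecMul, dotProduct, M, Pi.zero_apply]
    by_cases hk : k ∈ C
    · have : ∑ l, (if l ∈ C then (1 : ℝ) else 0) * T l k = ∑ l, T l k := by
        refine Finset.sum_congr rfl fun l _ => ?_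
        by_cases hl : l ∈ C
        · simp [hl]
        · simp [hl, hclosed k hk l hl]
      simp only [hk, if_true, this, Matrix.sum_col_of_mem_colStochastic hT, sub_self]
    · simp [hk]
  have hdet : (1 - M).det = 0 := by
    refine Matrix.exists_vecMul_eq_zero_iff.1 ⟨_, fun h => ?_, hleft⟩
    obtain ⟨k, hk⟩ := hne
    simpa [hk] using congrFun h k
  obtain ⟨v, hv0, hv⟩ := Matrix.exists_mulVec_eq_zero_iff.2 hdet
  have hMv : ∀ l, ∑ k, M l k * v k = v l := by
    intro l
    have := congrFun hv l
    rw [Matrix.sub_mulVec, Matrix.one_mulVec] at this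
    simp only [Pi.sub_apply, Matrix.mulVec, dotProduct, Pi.zero_apply] at this
    linarith
  have hsupp : ∀ l ∉ C, v l = 0 := by
    intro l hl
    rw [← hMv l]
    refine Finset.sum_eq_zero fun k _ => ?_
    by_cases hk : k ∈ C
    · simp [M, hk, hclosed k hk l hl]
    · simp [M, hk]
  have hTv : ∀ l, ∑ k, T l k * v k = v l := by
    intro l
    rw [← hMv l]
    refine Finset.sum_congr rfl fun k _ => ?_
    by_cases hk : k ∈ C
    · simp [M, hk]
    · simp [M, hk, hsupp k hk]
  -- Both sides have the same total because the columns of `T` sum to one, so equality holds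
  -- everywhere and `|v|` is fixed as well. Positivity then spreads backwards along edges.
  have hge : ∀ l, |v l| ≤ ∑ k, T l k * |v k| := by
    intro l
    rw [← hTv l]
    refine (Finset.abs_sum_le_sum_abs _ _).trans (Finset.sum_le_sum fun k _ => ?_)
    rw [abs_mul, abs_of_nonneg (hnn l k)]
  have hsum : ∑ l, |v l| = ∑ l, ∑ k, T l k * |v k| := by
    rw [Finset.sum_comm]
    simp [← Finset.sum_mul, Matrix.sum_col_of_mem_colStochastic hT]
  have heq : ∀ l, ∑ k, T l k * |v k| = |v l| := fun l =>
    ((Finset.sum_eq_sum_iff_of_le fun l _ => hge l).1 hsum l (Finset.mem_univ l)).symm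
  have hprop : ∀ a b, Relation.ReflTransGen (fun a b => 0 < T a b) a b → 0 < |v b| →
      0 < |v a| := by
    intro a b hab
    induction hab using Relation.ReflTransGen.head_induction_on with
    | refl => exact id
    | head h _ ih =>
      intro hb
      rename_i a c _
      rw [← heq a]
      refine lt_of_lt_of_le (mul_pos h (ih hb)) ?_
      exact Finset.single_le_sum (f := fun k => T a k * |v k|)
        (fun k _ => mul_nonneg (hnn a k) (abs_nonneg _)) (Finset.mem_univ c)
  obtain ⟨k₀, hk₀⟩ := Function.ne_iff.1 hv0
  have hk₀C : k₀ ∈ C := by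
    by_contra h
    exact hk₀ (hsupp k₀ h)
  exact ⟨fun k => |v k|, fun k => abs_nonneg _,
    fun k hk => hprop k k₀ (hconn k hk k₀ hk₀C) (abs_pos.2 hk₀), heq⟩

/-- If the agents split into groups that are connected and do not communicate with each other, then
the combination matrix has a fixed vector with positive entries. -/
lemma exists_pos_fixed_vector {K ι : Type*} [Fintype K] [DecidableEq K] [Fintype ι]
    {T : Matrix K K ℝ} (hT : T ∈ Matrix.colStochastic ℝ K) (net : K → ι)
    (hsep : ∀ k l, net k ≠ net l → T k l = 0)
    (hconn : ∀ k l, net k = net l → Relation.ReflTransGen (fun a b => 0 < T a b) k l) :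
    ∃ π : K → ℝ, (∀ k, 0 < π k) ∧ ∀ l, ∑ k, T l k * π k = π l := by
  have h : ∀ k₀ : K, ∃ π : K → ℝ, (∀ k, 0 ≤ π k) ∧ 0 < π k₀ ∧ ∀ l, ∑ k, T l k * π k = π l := by
    intro k₀
    obtain ⟨π, h1, h2, h3⟩ := exists_fixed_vector_of_connected hT {k | net k = net k₀} ⟨k₀, rfl⟩
      (fun k hk l hl => hsep l k fun h => hl (h.trans hk))
      (fun k hk l hl => hconn k l (hk.trans hl.symm))
    exact ⟨π, h1, h2 k₀ rfl, h3⟩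
  choose π h1 h2 h3 using h
  refine ⟨fun k => ∑ k₀, π k₀ k, fun k => ?_, fun l => ?_⟩
  · exact (h2 k).trans_le (Finset.single_le_sum (f := fun k₀ => π k₀ k)
      (fun k₀ _ => h1 k₀ k) (Finset.mem_univ k))
  · simp only [Finset.mul_sum]
    rw [Finset.sum_comm]
    exact Finset.sum_congr rfl fun k₀ _ => h3 k₀ l

/-! ### Maximum principle, influence matrix and contraction for a weakly connected network -/

variable {𝒮 𝓡 : Type*} [Fintype 𝒮] [Fintype 𝓡] [DecidableEq 𝒮] [DecidableEq 𝓡] {S R : ℕ}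
  {netS : 𝒮 → Fin S} {netR : 𝓡 → Fin R} {A : Matrix (𝒮 ⊕ 𝓡) (𝒮 ⊕ 𝓡) ℝ}

lemma IsWeaklyConnected.nonneg (hA : IsWeaklyConnected netS netR A) (k l : 𝒮 ⊕ 𝓡) : 0 ≤ A k l :=
  Matrix.nonneg_of_mem_colStochastic hA.leftStochastic

lemma IsWeaklyConnected.sum_col (hA : IsWeaklyConnected netS netR A) (k : 𝒮 ⊕ 𝓡) :
    ∑ l, A (Sum.inl l) k + ∑ l, A (Sum.inr l) k = 1 := by
  rw [← Fintype.sum_sum_type fun l => A l k]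
  exact Matrix.sum_col_of_mem_colStochastic hA.leftStochastic k

lemma IsWeaklyConnected.toBlocks₁₁_mem (hA : IsWeaklyConnected netS netR A) :
    A.toBlocks₁₁ ∈ Matrix.colStochastic ℝ 𝒮 := by
  rw [Matrix.mem_colStochastic]
  refine ⟨fun i j => hA.nonneg _ _, ?_⟩
  funext k
  have := hA.sum_col (Sum.inl k)
  simp only [hA.no_feedback, Finset.sum_const_zero, add_zero] at this
  simpa [Matrix.vecMul, dotProduct, Matrix.toBlocks₁₁] using this

lemma IsWeaklyConnected.send_connected (hA : IsWeaklyConnected netS netR A) {k l : 𝒮}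
    (h : netS k = netS l) :
    Relation.ReflTransGen (fun a b => 0 < A.toBlocks₁₁ a b) k l := by
  have h1 := (hA.send_strong (netS l)).1 (Sum.inl k) ⟨k, h, rfl⟩ (Sum.inl l) ⟨l, rfl, rfl⟩
  have h2 : ∀ b, Relation.ReflTransGen (fun a b => a ∈ Sum.inl '' {k : 𝒮 | netS k = netS l} ∧
      b ∈ Sum.inl '' {k : 𝒮 | netS k = netS l} ∧ 0 < A a b) (Sum.inl k) b →
      ∃ b', b = Sum.inl b' ∧ Relation.ReflTransGen (fun a b => 0 < A.toBlocks₁₁ a b) k b' := by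
    intro b hb
    induction hb with
    | refl => exact ⟨k, rfl, .refl⟩
    | tail _ h ih =>
      obtain ⟨b', rfl, hb'⟩ := ih
      obtain ⟨_, ⟨c, _, rfl⟩, h3⟩ := h
      exact ⟨c, rfl, hb'.tail h3⟩
  obtain ⟨b', hb, h3⟩ := h2 _ h1
  rwa [Sum.inl.inj hb]

lemma IsWeaklyConnected.exists_pos_fixed_vector (hA : IsWeaklyConnected netS netR A) :
    ∃ π : 𝒮 → ℝ, (∀ k, 0 < π k) ∧ ∀ l, ∑ k, A.toBlocks₁₁ l k * π k = π l :=
  SocialLearning.exists_pos_fixed_vector hA.toBlocks₁₁_mem netS hA.send_separate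
    fun _ _ h => hA.send_connected h

/-- Every receiving agent is reached by a path that starts at a sending agent. -/
lemma IsWeaklyConnected.exists_path (hA : IsWeaklyConnected netS netR A) (k : 𝓡) :
    ∃ l : 𝒮, Relation.ReflTransGen (fun a b => 0 < A a b) (Sum.inl l) (Sum.inr k) := by
  -- By triangularity, outside influence on a sub-network comes from a sender or from a receiving
  -- sub-network of smaller index.
  induction hr : netR k using WellFoundedLT.induction generalizing k with
  | ind r ih =>
    obtain ⟨k', l, hk', hl, hpos⟩ := hA.recv_influenced r
    have hpath : Relation.ReflTransGen (fun a b => 0 < A a b) (Sum.inr k') (Sum.inr k) :=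
      Relation.ReflTransGen.mono (fun _ _ h => h.2.2) _ _
        (hA.recv_connected r _ ⟨k', hk', rfl⟩ _ ⟨k, hr, rfl⟩)
    rcases l with l | l
    · exact ⟨l, hpath.head hpos⟩
    · have hlt : netR l < r := by
        refine lt_of_le_of_ne (not_lt.1 fun h => ?_) fun h => hl (by simp [h])
        rw [hA.recv_triangular l k' (by rwa [hk'])] at hpos
        exact lt_irrefl _ hpos
      obtain ⟨s, hs⟩ := ih _ hlt l rfl
      exact ⟨s, (hs.tail hpos).trans hpath⟩

/-- The maximum principle for the receiving agents. -/
lemma IsWeaklyConnected.nonpos_of_le (hA : IsWeaklyConnected netS netR A) {y : 𝓡 → ℝ}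
    (hy : ∀ k, y k ≤ ∑ l, A (Sum.inr l) (Sum.inr k) * y l) (k : 𝓡) : y k ≤ 0 := by
  obtain ⟨k₁, -, hmax⟩ := Finset.exists_max_image Finset.univ y ⟨k, Finset.mem_univ k⟩
  refine (hmax k (Finset.mem_univ k)).trans (not_lt.1 fun hM => ?_)
  -- If the maximum were positive, the extension by zero would lie strictly below it at the senders.
  -- This strictness passes along every edge, since `y` is bounded by an average, and would reach
  -- the maximizer itself.
  let z : 𝒮 ⊕ 𝓡 → ℝ := Sum.elim 0 y
  have hz : ∀ a, z a ≤ y k₁ := by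
    rintro (a | a)
    · exact hM.le
    · exact hmax a (Finset.mem_univ a)
  obtain ⟨s, hs⟩ := hA.exists_path k₁
  have key : ∀ b, Relation.ReflTransGen (fun a b => 0 < A a b) (Sum.inl s) b → z b < y k₁ := by
    intro b hb
    induction hb with
    | refl => exact hM
    | tail _ h ih =>
      rename_i a b _
      rcases b with b | b
      · exact hM
      · have h1 : z (Sum.inr b) ≤ ∑ l, A l (Sum.inr b) * z l := by
          rw [Fintype.sum_sum_type]
          simpa [z] using hy b
        have h2 : ∑ l, A l (Sum.inr b) * z l < ∑ l, A l (Sum.inr b) * y k₁ :=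
          Finset.sum_lt_sum (fun l _ => mul_le_mul_of_nonneg_left (hz l) (hA.nonneg _ _))
            ⟨a, Finset.mem_univ a, mul_lt_mul_of_pos_left ih h⟩
        rw [← Finset.sum_mul, Matrix.sum_col_of_mem_colStochastic hA.leftStochastic, one_mul] at h2
        exact h1.trans_lt h2
  exact lt_irrefl _ (key _ hs)

/-- The maximum principle applies to a left null vector and to its negative. -/
lemma IsWeaklyConnected.isUnit_one_sub (hA : IsWeaklyConnected netS netR A) :
    IsUnit (1 - A.toBlocks₂₂) := by
  rw [Matrix.isUnit_iff_isUnit_det, isUnit_iff_ne_zero]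
  intro h
  obtain ⟨v, hv0, hv⟩ := Matrix.exists_vecMul_eq_zero_iff.2 h
  have hv' : ∀ k, v k = ∑ l, A (Sum.inr l) (Sum.inr k) * v l := by
    intro k
    have := congrFun hv k
    rw [Matrix.vecMul_sub, Matrix.vecMul_one] at this
    simp only [Pi.sub_apply, Matrix.vecMul, dotProduct, Pi.zero_apply, Matrix.toBlocks₂₂,
      Matrix.of_apply] at this
    simp only [mul_comm (A _ _)]
    linarith
  refine hv0 (funext fun k => le_antisymm (hA.nonpos_of_le (fun k => (hv' k).le) k) ?_)
  have := hA.nonpos_of_le (y := fun k => - v k) (fun k => by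
    rw [hv' k]; simp) k
  simpa using this

lemma IsWeaklyConnected.inv_mul_cancel (hA : IsWeaklyConnected netS netR A) :
    (1 - A.toBlocks₂₂)⁻¹ * (1 - A.toBlocks₂₂) = 1 :=
  Matrix.nonsing_inv_mul _ ((Matrix.isUnit_iff_isUnit_det _).1 hA.isUnit_one_sub)

lemma IsWeaklyConnected.mul_inv_cancel (hA : IsWeaklyConnected netS netR A) :
    (1 - A.toBlocks₂₂) * (1 - A.toBlocks₂₂)⁻¹ = 1 :=
  Matrix.mul_nonsing_inv _ ((Matrix.isUnit_iff_isUnit_det _).1 hA.isUnit_one_sub)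

/-- A row of the inverse equals its own average plus a row of the identity matrix, so its negative
obeys the maximum principle. -/
lemma IsWeaklyConnected.inv_nonneg (hA : IsWeaklyConnected netS netR A) (l k : 𝓡) :
    0 ≤ (1 - A.toBlocks₂₂)⁻¹ l k := by
  have h := congrFun hA.inv_mul_cancel l
  have h' : ∀ k, (1 - A.toBlocks₂₂)⁻¹ l k = ∑ j, A (Sum.inr j) (Sum.inr k) *
      (1 - A.toBlocks₂₂)⁻¹ l j + (1 : Matrix 𝓡 𝓡 ℝ) l k := by
    intro k
    have := congrFun h k
    rw [mul_sub, mul_one, Matrix.sub_apply, Matrix.mul_apply] at this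
    simp only [Matrix.toBlocks₂₂, Matrix.of_apply] at this ⊢
    rw [← this]
    simp only [mul_comm (A _ _)]
    ring
  have := hA.nonpos_of_le (y := fun k => - (1 - A.toBlocks₂₂)⁻¹ l k) (fun k => by
    have h1 : (0 : ℝ) ≤ (1 : Matrix 𝓡 𝓡 ℝ) l k := by
      rw [Matrix.one_apply]; split_ifs <;> norm_num
    simp only [mul_neg, Finset.sum_neg_distrib]
    linarith [h' k]) k
  simpa using this

lemma IsWeaklyConnected.influence_nonneg (hA : IsWeaklyConnected netS netR A) (l : 𝒮) (k : 𝓡) :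
    0 ≤ influence A l k := by
  rw [influence, Matrix.mul_apply]
  exact Finset.sum_nonneg fun j _ => mul_nonneg (hA.nonneg _ _) (hA.inv_nonneg _ _)

/-- The relation `W = T_SR + W T_RR`: condition on the first step. It identifies the limit as a
fixed point of the linear dynamics. -/
lemma IsWeaklyConnected.influence_eq (hA : IsWeaklyConnected netS netR A) (l : 𝒮) (k : 𝓡) :
    influence A l k = A (Sum.inl l) (Sum.inr k) +
      ∑ j, A (Sum.inr j) (Sum.inr k) * influence A l j := by
  have h : influence A * (1 - A.toBlocks₂₂) = A.toBlocks₁₂ := by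
    rw [influence, Matrix.mul_assoc, hA.inv_mul_cancel, Matrix.mul_one]
  have := congrFun (congrFun h l) k
  rw [Matrix.mul_sub, Matrix.mul_one, Matrix.sub_apply, Matrix.mul_apply] at this
  simp only [Matrix.toBlocks₂₂, Matrix.toBlocks₁₂, Matrix.of_apply] at this
  simp only [mul_comm (A _ _)]
  linarith

/-- The defect `1 - ∑ W` equals its own average over the receiving agents, so the maximum principle,
used with both signs, makes it vanish. -/
lemma IsWeaklyConnected.sum_influence (hA : IsWeaklyConnected netS netR A) (k : 𝓡) :
    ∑ l, influence A l k = 1 := by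
  have h : ∀ k, 1 - ∑ l, influence A l k = ∑ j, A (Sum.inr j) (Sum.inr k) *
      (1 - ∑ l, influence A l j) := by
    intro k
    have h1 : ∑ l, influence A l k = ∑ l, A (Sum.inl l) (Sum.inr k) +
        ∑ j, A (Sum.inr j) (Sum.inr k) * ∑ l, influence A l j := by
      rw [Finset.sum_congr rfl fun l _ => hA.influence_eq l k, Finset.sum_add_distrib,
        Finset.sum_comm]
      simp only [Finset.mul_sum]
    simp only [mul_sub, mul_one, Finset.sum_sub_distrib]
    linarith [hA.sum_col (Sum.inr k)]
  have h1 := hA.nonpos_of_le (fun k => (h k).le) k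
  have h2 := hA.nonpos_of_le (y := fun k => - (1 - ∑ l, influence A l k)) (fun k => by
    rw [h k]; simp only [mul_neg, Finset.sum_neg_distrib, le_refl]) k
  linarith

/-- A weighted `ℓ¹` norm in which the receiving block of the matrix is a strict contraction. -/
lemma IsWeaklyConnected.exists_contraction_weight (hA : IsWeaklyConnected netS netR A) :
    ∃ (w : 𝓡 → ℝ) (ρ : ℝ), (∀ k, 1 ≤ w k) ∧ 0 < ρ ∧ ρ < 1 ∧
      ∀ l, ∑ k, A (Sum.inr l) (Sum.inr k) * w k ≤ ρ * w l := by
  -- This `w` solves `w = T_RR w + 1`. Any upper bound `b` for `w` gives `T_RR w = w - 1 ≤ (1 - 1/b)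
  -- w`; the choice `b = 2 + ∑ w` also keeps the factor positive.
  let w : 𝓡 → ℝ := fun l => ∑ k, (1 - A.toBlocks₂₂)⁻¹ l k
  have hw0 : ∀ l, 0 ≤ w l := fun l => Finset.sum_nonneg fun k _ => hA.inv_nonneg l k
  have hw : ∀ l, w l = ∑ k, A (Sum.inr l) (Sum.inr k) * w k + 1 := by
    intro l
    have h : ∀ k, (1 - A.toBlocks₂₂)⁻¹ l k =
        ∑ j, A (Sum.inr l) (Sum.inr j) * (1 - A.toBlocks₂₂)⁻¹ j k + (1 : Matrix 𝓡 𝓡 ℝ) l k := by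
      intro k
      have := congrFun (congrFun hA.mul_inv_cancel l) k
      rw [sub_mul, one_mul, Matrix.sub_apply, Matrix.mul_apply] at this
      simp only [Matrix.toBlocks₂₂, Matrix.of_apply] at this ⊢
      linarith
    simp only [w, Finset.mul_sum]
    rw [Finset.sum_congr rfl fun k _ => h k, Finset.sum_add_distrib, Finset.sum_comm]
    simp [Matrix.one_apply]
  have hw1 : ∀ l, 1 ≤ w l := fun l => by
    rw [hw l]
    have : 0 ≤ ∑ k, A (Sum.inr l) (Sum.inr k) * w k :=
      Finset.sum_nonneg fun k _ => mul_nonneg (hA.nonneg _ _) (hw0 k)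
    linarith
  have hle : ∀ l, w l ≤ 2 + ∑ k, w k := fun l => by
    have := Finset.single_le_sum (f := w) (fun k _ => hw0 k) (Finset.mem_univ l)
    linarith
  have hpos : 0 < 2 + ∑ k, w k := by
    have := Finset.sum_nonneg fun k (_ : k ∈ Finset.univ) => hw0 k
    linarith
  refine ⟨w, 1 - 1 / (2 + ∑ k, w k), hw1, ?_, ?_, fun l => ?_⟩
  · have : 1 / (2 + ∑ k, w k) < 1 := by
      rw [div_lt_one hpos]
      have := Finset.sum_nonneg fun k (_ : k ∈ Finset.univ) => hw0 k
      linarith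
    linarith
  · have : 0 < 1 / (2 + ∑ k, w k) := by positivity
    linarith
  · have h1 : 1 / (2 + ∑ k, w k) * w l ≤ 1 := by
      rw [div_mul_eq_mul_div, one_mul, div_le_one hpos]
      exact hle l
    linarith [hw l]

end Network

/-! ### Real sequences -/

section Sequences

lemma rpow_le_tangent {γ d d' : ℝ} (h0 : 0 ≤ γ) (h1 : γ ≤ 1) (hd : 0 < d) (hd' : 0 ≤ d') :
    d' ^ γ ≤ d ^ γ + γ * d ^ (γ - 1) * (d' - d) := by
  have h := rpow_one_add_le_one_add_mul_self (s := (d' - d) / d) (p := γ) (by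
    rw [le_div_iff₀ hd]; linarith) h0 h1
  have e1 : 1 + (d' - d) / d = d' / d := by field_simp; ring
  have hdp : 0 < d ^ γ := Real.rpow_pos_of_pos hd γ
  rw [e1, Real.div_rpow hd' hd.le, div_le_iff₀ hdp] at h
  rw [Real.rpow_sub_one hd.ne']
  calc d' ^ γ ≤ _ := h
    _ = _ := by field_simp

/-- `f x i ^ 2` is bounded by a constant times `D x i + ⋯ + D x (i + n - 1)`, uniformly in `x ∈ s`
and `i ≥ N`. -/
def SqControlled {X : Type*} (s : Set X) (N : ℕ) (D f : X → ℕ → ℝ) : Prop :=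
  ∃ (C : ℝ) (n : ℕ), 0 ≤ C ∧ ∀ x ∈ s, ∀ i, N ≤ i →
    f x i ^ 2 ≤ C * ∑ j ∈ Finset.range n, D x (i + j)

variable {X : Type*} {s : Set X} {N : ℕ} {D f g : X → ℕ → ℝ}

lemma SqControlled.add (hD : ∀ x i, 0 ≤ D x i) (hf : SqControlled s N D f)
    (hg : SqControlled s N D g) : SqControlled s N D fun x i => f x i + g x i := by
  obtain ⟨C, n, hC, h⟩ := hf
  obtain ⟨C', n', hC', h'⟩ := hg
  refine ⟨2 * C + 2 * C', max n n', by positivity, fun x hx i hi => ?_⟩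
  have h1 : ∑ j ∈ Finset.range n, D x (i + j) ≤ ∑ j ∈ Finset.range (max n n'), D x (i + j) :=
    Finset.sum_le_sum_of_subset_of_nonneg (Finset.range_mono (le_max_left _ _))
      fun _ _ _ => hD _ _
  have h2 : ∑ j ∈ Finset.range n', D x (i + j) ≤ ∑ j ∈ Finset.range (max n n'), D x (i + j) :=
    Finset.sum_le_sum_of_subset_of_nonneg (Finset.range_mono (le_max_right _ _))
      fun _ _ _ => hD _ _
  nlinarith [h x hx i hi, h' x hx i hi, mul_le_mul_of_nonneg_left h1 hC,
    mul_le_mul_of_nonneg_left h2 hC', sq_nonneg (f x i - g x i)]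

lemma SqControlled.const_mul (c : ℝ) (hf : SqControlled s N D f) :
    SqControlled s N D fun x i => c * f x i := by
  obtain ⟨C, n, hC, h⟩ := hf
  refine ⟨c ^ 2 * C, n, by positivity, fun x hx i hi => ?_⟩
  rw [mul_pow, mul_assoc]
  exact mul_le_mul_of_nonneg_left (h x hx i hi) (sq_nonneg c)

lemma SqControlled.zero : SqControlled s N D fun _ _ => 0 :=
  ⟨0, 0, le_rfl, fun _ _ _ _ => by simp⟩

lemma SqControlled.sum {ι : Type*} (hD : ∀ x i, 0 ≤ D x i) (t : Finset ι)
    {F : ι → X → ℕ → ℝ} (hF : ∀ a ∈ t, SqControlled s N D (F a)) :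
    SqControlled s N D fun x i => ∑ a ∈ t, F a x i := by
  classical
  induction t using Finset.induction_on with
  | empty => simpa using SqControlled.zero
  | insert a t ha ih =>
    simp only [Finset.sum_insert ha]
    exact (hF a (by simp)).add hD (ih fun b hb => hF b (by simp [hb]))

lemma SqControlled.of_le (hf : SqControlled s N D f)
    (h : ∀ x ∈ s, ∀ i, N ≤ i → 0 ≤ g x i ∧ g x i ≤ f x i) : SqControlled s N D g := by
  obtain ⟨C, n, hC, h'⟩ := hf
  refine ⟨C, n, hC, fun x hx i hi => ?_⟩
  obtain ⟨h0, h1⟩ := h x hx i hi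
  exact (pow_le_pow_left₀ h0 h1 2).trans (h' x hx i hi)

/-- A bound by the next time costs one more term in the window. This is how control passes along one
edge of the network. -/
lemma SqControlled.of_shift (hD : ∀ x i, 0 ≤ D x i) (hf : SqControlled s N D f)
    (h : ∀ x ∈ s, ∀ i, N ≤ i → 0 ≤ g x i ∧ g x i ≤ f x (i + 1)) : SqControlled s N D g := by
  obtain ⟨C, n, hC, h'⟩ := hf
  refine ⟨C, n + 1, hC, fun x hx i hi => ?_⟩
  obtain ⟨h0, h1⟩ := h x hx i hi
  refine (pow_le_pow_left₀ h0 h1 2).trans ((h' x hx (i + 1) (by omega)).trans ?_)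
  refine mul_le_mul_of_nonneg_left ?_ hC
  rw [Finset.sum_range_succ']
  have : ∀ j, i + 1 + j = i + (j + 1) := fun j => by ring
  simp only [this]
  linarith [hD x (i + 0)]

lemma SqControlled.tendsto_zero (hf : SqControlled s N D f) {x : X} (hx : x ∈ s)
    (hsum : Summable (D x)) : Tendsto (f x) atTop (𝓝 0) := by
  obtain ⟨C, n, hC, h⟩ := hf
  have h1 : Tendsto (fun i => C * ∑ j ∈ Finset.range n, D x (i + j)) atTop (𝓝 0) := by
    have := (tendsto_finsetSum (Finset.range n) fun j _ =>
      (tendsto_add_atTop_iff_nat j).2 hsum.tendsto_atTop_zero).const_mul C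
    simpa using this
  have h2 : Tendsto (fun i => f x i ^ 2) atTop (𝓝 0) :=
    squeeze_zero' (Eventually.of_forall fun i => sq_nonneg _)
      (eventually_atTop.2 ⟨N, fun i hi => h x hx i hi⟩) h1
  have h3 := h2.sqrt
  simp only [Real.sqrt_sq_eq_abs, Real.sqrt_zero] at h3
  exact (tendsto_zero_iff_abs_tendsto_zero _).2 h3

/-- Write `e^(1+γ) = e^(γ-1) e²` and bound `e²` by a window of `D`. Since `γ - 1 ≤ 0`, the factor `e
i ^ (γ-1)` may be replaced by `d (i+j) ^ (γ-1)` as soon as `d (i+j)` is at most a constant times `e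
i`; bounded growth provides this. -/
lemma summable_rpow_of_sq_le {γ B C : ℝ} (hγ : γ ≤ 1) (hB : 1 ≤ B) (hC : 0 ≤ C) {M n : ℕ}
    {d e D : ℕ → ℝ} (hD : ∀ i, 0 ≤ D i) (he : ∀ i, M ≤ i → 0 < e i)
    (hed : ∀ i, M ≤ i → e i ≤ d i) (hde : ∀ i, M ≤ i → d i ≤ 2 * e i)
    (hgrow : ∀ i, M ≤ i → e (i + 1) ≤ B * e i)
    (hsq : ∀ i, M ≤ i → e i ^ 2 ≤ C * ∑ j ∈ Finset.range n, D (i + j))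
    (hsum : Summable fun i => d i ^ (γ - 1) * D i) : Summable fun i => e i ^ (1 + γ) := by
  have hgrow' : ∀ j i, M ≤ i → e (i + j) ≤ B ^ j * e i := by
    intro j i hi
    induction j with
    | zero => simp
    | succ j ih =>
      calc e (i + (j + 1)) ≤ B * e (i + j) := hgrow (i + j) (by omega)
        _ ≤ B * (B ^ j * e i) := mul_le_mul_of_nonneg_left ih (by linarith)
        _ = _ := by ring
  have hK : 0 < 2 * B ^ n := by positivity
  have hkey : ∀ i, M ≤ i → ∀ j ∈ Finset.range n,
      e i ^ (γ - 1) ≤ (2 * B ^ n) ^ (1 - γ) * d (i + j) ^ (γ - 1) := by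
    intro i hi j hj
    have hdpos : 0 < d (i + j) := (he _ (by omega)).trans_le (hed _ (by omega))
    have h1 : d (i + j) ≤ 2 * B ^ n * e i := by
      have h2 := hde (i + j) (by omega)
      have h3 := hgrow' j i hi
      have h4 : B ^ j * e i ≤ B ^ n * e i :=
        mul_le_mul_of_nonneg_right (pow_le_pow_right₀ hB (Finset.mem_range.1 hj).le) (he i hi).le
      linarith
    have h2 : d (i + j) / (2 * B ^ n) ≤ e i := by rwa [div_le_iff₀' hK]
    have h3 := Real.rpow_le_rpow_of_nonpos (div_pos hdpos hK) h2 (by linarith : γ - 1 ≤ 0)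
    rw [Real.div_rpow hdpos.le hK.le] at h3
    rw [show 1 - γ = -(γ - 1) by ring, Real.rpow_neg hK.le]
    calc _ ≤ _ := h3
      _ = _ := by rw [div_eq_inv_mul]
  have hbound : Summable fun i => C * ((2 * B ^ n) ^ (1 - γ) *
      ∑ j ∈ Finset.range n, d (i + j) ^ (γ - 1) * D (i + j)) := by
    refine Summable.mul_left _ (Summable.mul_left _ (summable_sum fun j _ => ?_))
    exact (summable_nat_add_iff (f := fun i => d i ^ (γ - 1) * D i) j).2 hsum
  rw [← summable_nat_add_iff M] at hbound ⊢
  refine Summable.of_nonneg_of_le (fun i => Real.rpow_nonneg (he _ (by omega)).le _)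
    (fun i => ?_) hbound
  have hi : M ≤ i + M := by omega
  have hpos := he _ hi
  have e1 : e (i + M) ^ (1 + γ) = e (i + M) ^ (γ - 1) * e (i + M) ^ 2 := by
    rw [← Real.rpow_natCast, ← Real.rpow_add hpos]
    congr 1
    push_cast
    ring
  rw [e1]
  calc _ ≤ e (i + M) ^ (γ - 1) * (C * ∑ j ∈ Finset.range n, D (i + M + j)) :=
        mul_le_mul_of_nonneg_left (hsq _ hi) (Real.rpow_nonneg hpos.le _)
    _ = C * ∑ j ∈ Finset.range n, e (i + M) ^ (γ - 1) * D (i + M + j) := by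
        rw [← Finset.mul_sum]; ring
    _ ≤ C * ∑ j ∈ Finset.range n,
        (2 * B ^ n) ^ (1 - γ) * d (i + M + j) ^ (γ - 1) * D (i + M + j) := by
        refine mul_le_mul_of_nonneg_left (Finset.sum_le_sum fun j hj => ?_) hC
        exact mul_le_mul_of_nonneg_right (hkey _ hi j hj) (hD _)
    _ = _ := by
        congr 1
        rw [Finset.mul_sum]
        exact Finset.sum_congr rfl fun j _ => by ring

end Sequences

/-! ### Learning in the sending sub-networks -/

section Sending

variable {K Θ : Type*} [Fintype K] [Fintype Θ] {Z : K → Type*} [∀ k, Fintype (Z k)]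
  {T : Matrix K K ℝ} {L : ∀ k, Θ → Z k → ℝ} {μ₀ : K → Θ → ℝ} {θ₀ : K → Θ}

/-! ### Positive belief in the true state spreads through each sending sub-network -/

section Positivity

variable [DecidableEq K]

lemma belief_succ_pos (hT : T ∈ Matrix.colStochastic ℝ K) (hL : ∀ k θ, IsProbVec (L k θ))
    (hμ₀ : ∀ k, IsProbVec (μ₀ k)) (hθ : ∀ l k, 0 < T l k → θ₀ l = θ₀ k) {x : ℕ → ∀ k, Z k}
    (hx : IsTypical L θ₀ x) {i : ℕ} {l k : K} (hlk : 0 < T l k)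
    (h : 0 < belief T L μ₀ x i l (θ₀ l)) : 0 < belief T L μ₀ x (i + 1) k (θ₀ k) := by
  rw [belief_succ]
  refine lt_of_lt_of_le ?_ (Finset.single_le_sum
    (f := fun l => T l k * bayesUpdate (L l) (belief T L μ₀ x i l) (x (i + 1) l) (θ₀ k))
    (fun l _ => mul_nonneg (Matrix.nonneg_of_mem_colStochastic hT)
      (bayesUpdate_nonneg (hL l) (belief_nonneg hT hL hμ₀ x i l) _ _)) (Finset.mem_univ l))
  rw [← hθ l k hlk]
  exact mul_pos hlk (bayesUpdate_pos (hL l) (belief_nonneg hT hL hμ₀ x i l) h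
    (hx (i + 1) (by omega) l))

/-- After a fixed time, all agents assign positive belief to their true states. -/
lemma exists_forall_belief_pos (hT : T ∈ Matrix.colStochastic ℝ K)
    (hL : ∀ k θ, IsProbVec (L k θ)) (hμ₀ : ∀ k, IsProbVec (μ₀ k))
    (hθ : ∀ l k, 0 < T l k → θ₀ l = θ₀ k)
    (hreach : ∀ k, ∃ k₀ h, Relation.ReflTransGen (fun a b => 0 < T a b) k₀ h ∧
      Relation.ReflTransGen (fun a b => 0 < T a b) h k ∧ 0 < T h h ∧ 0 < μ₀ k₀ (θ₀ k₀)) :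
    ∃ N, ∀ x, IsTypical L θ₀ x → ∀ i, N ≤ i → ∀ k, 0 < belief T L μ₀ x i k (θ₀ k) ∧
      ∑ θ, belief T L μ₀ x i k θ = 1 := by
  have hk : ∀ k, ∃ N, ∀ i, N ≤ i → ∀ x, IsTypical L θ₀ x → 0 < belief T L μ₀ x i k (θ₀ k) := by
    intro k
    obtain ⟨k₀, h, h1, h2, hloop, hpos⟩ := hreach k
    have hh : ∃ n, ∀ x, IsTypical L θ₀ x → 0 < belief T L μ₀ x n h (θ₀ h) := by
      clear h2 hloop
      induction h1 with
      | refl => exact ⟨0, fun x _ => hpos⟩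
      | tail _ hbc ih =>
        obtain ⟨n, hn⟩ := ih
        exact ⟨n + 1, fun x hx => belief_succ_pos hT hL hμ₀ hθ hx hbc (hn x hx)⟩
    obtain ⟨n, hn⟩ := hh
    -- The self-loop keeps positivity at `h` for all later times, which rules out periodic
    -- behaviour.
    have hstay : ∀ i, n ≤ i → ∀ x, IsTypical L θ₀ x → 0 < belief T L μ₀ x i h (θ₀ h) := by
      intro i hi x hx
      induction i, hi using Nat.le_induction with
      | base => exact hn x hx
      | succ i _ ih => exact belief_succ_pos hT hL hμ₀ hθ hx hloop ih
    clear hn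
    induction h2 with
    | refl => exact ⟨n, hstay⟩
    | tail _ hbc ih =>
      obtain ⟨N, hN⟩ := ih
      refine ⟨N + 1, fun i hi x hx => ?_⟩
      obtain ⟨j, rfl⟩ : ∃ j, i = j + 1 := ⟨i - 1, by omega⟩
      exact belief_succ_pos hT hL hμ₀ hθ hx hbc (hN j (by omega) x hx)
  choose N hN using hk
  have hN' : ∀ i, ∑ k, N k ≤ i → ∀ x, IsTypical L θ₀ x → ∀ k, 0 < belief T L μ₀ x i k (θ₀ k) :=
    fun i hi x hx k => hN k i ((Finset.single_le_sum (fun _ _ => Nat.zero_le _)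
      (Finset.mem_univ k)).trans hi) x hx
  -- One more step is needed for the mass: once all evidences are positive, the following beliefs
  -- sum to one.
  refine ⟨∑ k, N k + 1, fun x hx i hi k => ⟨hN' i (by omega) x hx k, ?_⟩⟩
  obtain ⟨j, rfl⟩ : ∃ j, i = j + 1 := ⟨i - 1, by omega⟩
  rw [sum_belief_succ]
  have h1 : ∀ l, ∑ θ, bayesUpdate (L l) (belief T L μ₀ x j l) (x (j + 1) l) θ = 1 := by
    intro l
    refine sum_bayesUpdate_eq_one (ne_of_gt ?_)
    exact (mul_pos (hN' j (by omega) x hx l) (hx (j + 1) (by omega) l)).trans_le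
      (mul_le_evidence (hL l) (belief_nonneg hT hL hμ₀ x j l) _ _)
  simp [h1, Matrix.sum_col_of_mem_colStochastic hT]

end Positivity

/-- The logarithmic loss of the beliefs `b` at time `i`; the summand `(1/2)^i` keeps it positive. -/
noncomputable def logLoss (π : K → ℝ) (θ₀ : K → Θ) (b : K → Θ → ℝ) (i : ℕ) : ℝ :=
  (1 / 2) ^ i + ∑ k, π k * (-Real.log (b k (θ₀ k)))

/-- The weighted belief in the wrong states at time `i`. -/
noncomputable def linLoss (π : K → ℝ) (θ₀ : K → Θ) (b : K → Θ → ℝ) (i : ℕ) : ℝ :=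
  (1 / 2) ^ i + ∑ k, π k * (1 - b k (θ₀ k))

/-- The weighted error in the prediction of the next signals at time `i`. -/
noncomputable def predictionLoss (π : K → ℝ) (L : ∀ k, Θ → Z k → ℝ) (θ₀ : K → Θ) (b : K → Θ → ℝ)
    (i : ℕ) : ℝ :=
  (1 / 4) ^ (i + 1) + ∑ k, π k * hellingerSq (L k (θ₀ k)) (evidence (L k) (b k))

omit [Fintype Θ] [∀ k, Fintype (Z k)] in
lemma linLoss_le_logLoss {π : K → ℝ} (hπ : ∀ k, 0 < π k) {b : K → Θ → ℝ} {i : ℕ}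
    (hb : ∀ k, 0 < b k (θ₀ k)) : linLoss π θ₀ b i ≤ logLoss π θ₀ b i := by
  refine add_le_add_right (Finset.sum_le_sum fun k _ => ?_) _
  refine mul_le_mul_of_nonneg_left ?_ (hπ k).le
  linarith [Real.log_le_sub_one_of_pos (hb k)]

omit [Fintype Θ] [∀ k, Fintype (Z k)] in
-- For `b ≥ 1/2`, `-log b ≤ 1/b - 1 ≤ 2 (1 - b)`. The drift concerns the logarithmic loss, while
-- growth and quadratic control concern the linear one; near the truth the two are comparable.
lemma logLoss_le_linLoss {π : K → ℝ} (hπ : ∀ k, 0 < π k) {b : K → Θ → ℝ} {i : ℕ}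
    (hb : ∀ k, 1 / 2 ≤ b k (θ₀ k)) (hb1 : ∀ k, b k (θ₀ k) ≤ 1) :
    logLoss π θ₀ b i ≤ 2 * linLoss π θ₀ b i := by
  have h1 : (0 : ℝ) < (1 / 2) ^ i := by positivity
  have h2 : ∑ k, π k * (-Real.log (b k (θ₀ k))) ≤ 2 * ∑ k, π k * (1 - b k (θ₀ k)) := by
    rw [Finset.mul_sum]
    refine Finset.sum_le_sum fun k _ => ?_
    have hpos : 0 < b k (θ₀ k) := by linarith [hb k]
    have h3 := Real.log_le_sub_one_of_pos (inv_pos.2 hpos)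
    rw [Real.log_inv] at h3
    have h4 : (b k (θ₀ k))⁻¹ - 1 ≤ 2 * (1 - b k (θ₀ k)) := by
      have : (b k (θ₀ k))⁻¹ - 1 = (1 - b k (θ₀ k)) / b k (θ₀ k) := by field_simp
      rw [this, div_le_iff₀ hpos]
      nlinarith [hb k, hb1 k]
    nlinarith [hπ k, mul_le_mul_of_nonneg_left (h3.trans h4) (hπ k).le]
  simp only [logLoss, linLoss]
  linarith

omit [Fintype Θ] [∀ k, Fintype (Z k)] in
lemma linLoss_pos {π : K → ℝ} (hπ : ∀ k, 0 < π k) {b : K → Θ → ℝ} (i : ℕ)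
    (hb1 : ∀ k, b k (θ₀ k) ≤ 1) : 0 < linLoss π θ₀ b i := by
  have h1 : (0 : ℝ) < (1 / 2) ^ i := by positivity
  have h2 : 0 ≤ ∑ k, π k * (1 - b k (θ₀ k)) :=
    Finset.sum_nonneg fun k _ => mul_nonneg (hπ k).le (sub_nonneg.2 (hb1 k))
  simp only [linLoss]
  linarith

omit [Fintype Θ] [∀ k, Fintype (Z k)] in
lemma mul_one_sub_le_linLoss {π : K → ℝ} (hπ : ∀ k, 0 < π k) {b : K → Θ → ℝ} (i : ℕ)
    (hb1 : ∀ k, b k (θ₀ k) ≤ 1) (k : K) : π k * (1 - b k (θ₀ k)) ≤ linLoss π θ₀ b i := by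
  have h1 : (0 : ℝ) < (1 / 2) ^ i := by positivity
  have h2 := Finset.single_le_sum (f := fun k => π k * (1 - b k (θ₀ k)))
    (fun k _ => mul_nonneg (hπ k).le (sub_nonneg.2 (hb1 k))) (Finset.mem_univ k)
  simp only [linLoss]
  linarith

omit [Fintype Θ] [∀ k, Fintype (Z k)] in
lemma logLoss_pos {π : K → ℝ} (hπ : ∀ k, 0 < π k) {b : K → Θ → ℝ} {i : ℕ}
    (hb : ∀ k, 0 < b k (θ₀ k)) (hb1 : ∀ k, b k (θ₀ k) ≤ 1) : 0 < logLoss π θ₀ b i :=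
  (linLoss_pos hπ i hb1).trans_le (linLoss_le_logLoss hπ hb)

lemma predictionLoss_nonneg {π : K → ℝ} (hπ : ∀ k, 0 < π k) (b : K → Θ → ℝ) (i : ℕ) :
    0 ≤ predictionLoss π L θ₀ b i :=
  add_nonneg (by positivity)
    (Finset.sum_nonneg fun k _ => mul_nonneg (hπ k).le (hellingerSq_nonneg _ _))

variable [DecidableEq K]

/-- One step of the diffusion strategy decreases the logarithmic loss by the innovation. -/
lemma logLoss_succ_le (hT : T ∈ Matrix.colStochastic ℝ K) (hL : ∀ k θ, IsProbVec (L k θ))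
    (hμ₀ : ∀ k, IsProbVec (μ₀ k)) (hθ : ∀ l k, 0 < T l k → θ₀ l = θ₀ k)
    {π : K → ℝ} (hπ : ∀ k, 0 < π k) (hfix : ∀ l, ∑ k, T l k * π k = π l)
    {x : ℕ → ∀ k, Z k} (hx : IsTypical L θ₀ x) {i : ℕ}
    (hpos : ∀ k, 0 < belief T L μ₀ x i k (θ₀ k)) :
    logLoss π θ₀ (belief T L μ₀ x (i + 1)) (i + 1) ≤ logLoss π θ₀ (belief T L μ₀ x i) i -
      (1 / 4) ^ (i + 1) - ∑ l, π l * (2 * (1 - √(evidence (L l) (belief T L μ₀ x i l)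
        (x (i + 1) l) / L l (θ₀ l) (x (i + 1) l)))) := by
  have hnn : ∀ l k, 0 ≤ T l k := fun l k => Matrix.nonneg_of_mem_colStochastic hT
  set ψ : K → ℝ := fun l => bayesUpdate (L l) (belief T L μ₀ x i l) (x (i + 1) l) (θ₀ l)
  have hψ : ∀ l, 0 < ψ l := fun l => bayesUpdate_pos (hL l) (belief_nonneg hT hL hμ₀ x i l)
    (hpos l) (hx (i + 1) (by omega) l)
  -- Positive weights only join agents with the same true state, so each update can be evaluated at
  -- the sender's own state.
  have hb : ∀ k, belief T L μ₀ x (i + 1) k (θ₀ k) = ∑ l, T l k * ψ l := by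
    intro k
    rw [belief_succ]
    refine Finset.sum_congr rfl fun l _ => ?_
    rcases (hnn l k).eq_or_lt with h | h
    · simp [← h]
    · simp only [ψ, hθ l k h]
  have hjensen : ∀ k, -Real.log (belief T L μ₀ x (i + 1) k (θ₀ k)) ≤
      ∑ l, T l k * (-Real.log (ψ l)) := by
    intro k
    have := strictConcaveOn_log_Ioi.concaveOn.le_map_sum (t := Finset.univ)
      (w := fun l => T l k) (p := ψ) (fun l _ => hnn l k)
      (Matrix.sum_col_of_mem_colStochastic hT k) (fun l _ => hψ l)
    simp only [smul_eq_mul] at this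
    rw [hb k]
    simp only [mul_neg, Finset.sum_neg_distrib]
    linarith
  -- With `r` the ratio of evidence to true likelihood, `log r = 2 log √r ≤ 2 (√r - 1)`; the square
  -- root produces the Hellinger form.
  have hlog : ∀ l, -Real.log (ψ l) ≤ -Real.log (belief T L μ₀ x i l (θ₀ l)) -
      2 * (1 - √(evidence (L l) (belief T L μ₀ x i l) (x (i + 1) l) /
        L l (θ₀ l) (x (i + 1) l))) := by
    intro l
    have hLpos := hx (i + 1) (by omega) l
    have hm : 0 < evidence (L l) (belief T L μ₀ x i l) (x (i + 1) l) :=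
      (mul_pos (hpos l) hLpos).trans_le
        (mul_le_evidence (hL l) (belief_nonneg hT hL hμ₀ x i l) _ _)
    have h1 := Real.log_le_sub_one_of_pos (Real.sqrt_pos.2 (div_pos hm hLpos))
    rw [Real.log_sqrt (div_pos hm hLpos).le, Real.log_div hm.ne' hLpos.ne'] at h1
    simp only [ψ, bayesUpdate_eq]
    rw [Real.log_div (mul_pos (hpos l) hLpos).ne' hm.ne', Real.log_mul (hpos l).ne' hLpos.ne']
    linarith
  have hsum : ∑ k, π k * (-Real.log (belief T L μ₀ x (i + 1) k (θ₀ k))) ≤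
      ∑ l, π l * (-Real.log (ψ l)) := by
    calc _ ≤ ∑ k, π k * ∑ l, T l k * (-Real.log (ψ l)) :=
          Finset.sum_le_sum fun k _ => mul_le_mul_of_nonneg_left (hjensen k) (hπ k).le
      _ = ∑ l, (∑ k, T l k * π k) * (-Real.log (ψ l)) := by
          simp only [Finset.mul_sum, Finset.sum_mul]
          rw [Finset.sum_comm]
          exact Finset.sum_congr rfl fun _ _ => Finset.sum_congr rfl fun _ _ => by ring
      _ = _ := by simp only [hfix]
  have hsum2 : ∑ l, π l * (-Real.log (ψ l)) ≤
      ∑ l, π l * (-Real.log (belief T L μ₀ x i l (θ₀ l))) -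
      ∑ l, π l * (2 * (1 - √(evidence (L l) (belief T L μ₀ x i l) (x (i + 1) l) /
        L l (θ₀ l) (x (i + 1) l)))) := by
    rw [← Finset.sum_sub_distrib]
    refine Finset.sum_le_sum fun l _ => ?_
    rw [← mul_sub]
    exact mul_le_mul_of_nonneg_left (hlog l) (hπ l).le
  have hgeom : (1 / 2 : ℝ) ^ (i + 1) ≤ (1 / 2) ^ i - (1 / 4) ^ (i + 1) := by
    have h1 : (1 / 4 : ℝ) ^ (i + 1) ≤ (1 / 2) ^ (i + 1) := by gcongr; norm_num
    have h2 : (1 / 2 : ℝ) ^ i = 2 * (1 / 2) ^ (i + 1) := by rw [pow_succ]; ring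
    linarith
  simp only [logLoss]
  linarith

/-- Summing the one-observation bound against the fixed vector π leaves the constant unchanged. This
is the bounded growth required by `summable_rpow_of_sq_le`. -/
lemma linLoss_succ_le (hT : T ∈ Matrix.colStochastic ℝ K) (hL : ∀ k θ, IsProbVec (L k θ))
    (hμ₀ : ∀ k, IsProbVec (μ₀ k)) (hθ : ∀ l k, 0 < T l k → θ₀ l = θ₀ k)
    {π : K → ℝ} (hπ : ∀ k, 0 < π k) (hfix : ∀ l, ∑ k, T l k * π k = π l)
    {c : ℝ} (hc : 0 < c) (hc1 : c ≤ 1) (hcL : ∀ k ζ, 0 < L k (θ₀ k) ζ → c ≤ L k (θ₀ k) ζ)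
    {x : ℕ → ∀ k, Z k} (hx : IsTypical L θ₀ x) (i : ℕ) :
    linLoss π θ₀ (belief T L μ₀ x (i + 1)) (i + 1) ≤
      2 / c * linLoss π θ₀ (belief T L μ₀ x i) i := by
  have hnn : ∀ l k, 0 ≤ T l k := fun l k => Matrix.nonneg_of_mem_colStochastic hT
  have hb : ∀ k, 1 - belief T L μ₀ x (i + 1) k (θ₀ k) ≤
      ∑ l, T l k * (2 / c * (1 - belief T L μ₀ x i l (θ₀ l))) := by
    intro k
    have h1 := one_sub_sum_belief_succ (L := L) (μ₀ := μ₀) hT x i k {θ₀ k}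
    simp only [Finset.sum_singleton] at h1
    rw [h1]
    refine Finset.sum_le_sum fun l _ => ?_
    rcases (hnn l k).eq_or_lt with h | h
    · simp [← h]
    · refine mul_le_mul_of_nonneg_left ?_ h.le
      have h2 := one_sub_sum_bayesUpdate_le (E := {θ₀ l}) (L₀ := L l (θ₀ l)) (hL l)
        (belief_nonneg hT hL hμ₀ x i l) (sum_belief_le_one hT hμ₀ x i l)
        (by simp) hc hc1 (hcL l _ (hx (i + 1) (by omega) l))
      simpa [hθ l k h] using h2
  have hsum : ∑ k, π k * (1 - belief T L μ₀ x (i + 1) k (θ₀ k)) ≤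
      2 / c * ∑ l, π l * (1 - belief T L μ₀ x i l (θ₀ l)) := by
    calc _ ≤ ∑ k, π k * ∑ l, T l k * (2 / c * (1 - belief T L μ₀ x i l (θ₀ l))) :=
          Finset.sum_le_sum fun k _ => mul_le_mul_of_nonneg_left (hb k) (hπ k).le
      _ = ∑ l, (∑ k, T l k * π k) * (2 / c * (1 - belief T L μ₀ x i l (θ₀ l))) := by
          simp only [Finset.mul_sum, Finset.sum_mul]
          rw [Finset.sum_comm]
          exact Finset.sum_congr rfl fun _ _ => Finset.sum_congr rfl fun _ _ => by ring
      _ = _ := by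
          simp only [hfix, Finset.mul_sum]
          exact Finset.sum_congr rfl fun _ _ => by ring
  have h2c : 2 ≤ 2 / c := by rw [le_div_iff₀ hc]; linarith
  have hgeom : (1 / 2 : ℝ) ^ (i + 1) ≤ 2 / c * (1 / 2) ^ i := by
    have h1 : (0 : ℝ) < (1 / 2) ^ i := by positivity
    rw [pow_succ]
    nlinarith
  simp only [linLoss, mul_add]
  linarith

/-- The belief in the wrong states is controlled by the prediction errors of the following steps. -/
lemma sqControlled_linLoss (hT : T ∈ Matrix.colStochastic ℝ K) (hL : ∀ k θ, IsProbVec (L k θ))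
    (hμ₀ : ∀ k, IsProbVec (μ₀ k)) {π : K → ℝ} (hπ : ∀ k, 0 < π k)
    (hprev : ∀ k, ∃ ζ, IsPrevailing (L k) (θ₀ k) ζ)
    (hident : ∀ k θ, θ ≠ θ₀ k → ∃ l, Relation.ReflTransGen (fun a b => 0 < T a b) k l ∧
      θ ∉ indistinguishable (L l) (θ₀ l)) {N : ℕ}
    (hN : ∀ x, IsTypical L θ₀ x → ∀ i, N ≤ i → ∀ k, 0 < belief T L μ₀ x i k (θ₀ k) ∧
      ∑ θ, belief T L μ₀ x i k θ = 1) :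
    SqControlled {x | IsTypical L θ₀ x} N
      (fun x i => predictionLoss π L θ₀ (belief T L μ₀ x i) i)
      (fun x i => linLoss π θ₀ (belief T L μ₀ x i) i) := by
  classical
  set D : (ℕ → ∀ k, Z k) → ℕ → ℝ :=
    fun x i => predictionLoss π L θ₀ (belief T L μ₀ x i) i
  have hD : ∀ x i, 0 ≤ D x i := fun x i => predictionLoss_nonneg hπ _ _
  have hnn : ∀ l k, 0 ≤ T l k := fun l k => Matrix.nonneg_of_mem_colStochastic hT
  have hdist : ∀ k θ, θ ∉ indistinguishable (L k) (θ₀ k) →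
      SqControlled {x | IsTypical L θ₀ x} N D fun x i => belief T L μ₀ x i k θ := by
    intro k θ hθ
    obtain ⟨ζ, hζ⟩ := hprev k
    obtain ⟨C, hC, h⟩ := exists_sq_le_hellingerSq (hL k) hζ hθ
    have hpk := hπ k
    refine ⟨C / π k, 1, by positivity, fun x hx i hi => ?_⟩
    have h1 := h _ (belief_nonneg hT hL hμ₀ x i k) (hN x hx i hi k).2
    have h2 : π k * hellingerSq (L k (θ₀ k)) (evidence (L k) (belief T L μ₀ x i k)) ≤ D x i := by
      have h3 := Finset.single_le_sum
        (f := fun k => π k * hellingerSq (L k (θ₀ k)) (evidence (L k) (belief T L μ₀ x i k)))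
        (fun k _ => mul_nonneg (hπ k).le (hellingerSq_nonneg _ _)) (Finset.mem_univ k)
      have h4 : (0 : ℝ) < (1 / 4) ^ (i + 1) := by positivity
      simp only [D, predictionLoss]
      linarith
    simp only [Finset.range_one, Finset.sum_singleton, add_zero]
    refine h1.trans ?_
    rw [div_mul_eq_mul_div, le_div_iff₀ hpk]
    nlinarith
  -- Follow a path to an agent that distinguishes `θ`. An agent `a` that cannot do so retains at
  -- least the fraction `e` of its belief in `θ`, since the evidence is at most one, and passes it
  -- on with weight `T a c`; hence its belief is controlled by that of `c` one step later.
  have hwrong : ∀ k θ, θ ≠ θ₀ k →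
      SqControlled {x | IsTypical L θ₀ x} N D fun x i => belief T L μ₀ x i k θ := by
    intro k θ hne
    obtain ⟨l, hpath, hl⟩ := hident k θ hne
    clear hne
    induction hpath using Relation.ReflTransGen.head_induction_on with
    | refl => exact hdist l θ hl
    | head hac _ ih =>
      rename_i a c _
      by_cases ha : θ ∈ indistinguishable (L a) (θ₀ a)
      · obtain ⟨e, he, -, heL⟩ := exists_lower_bound L θ₀
        refine (ih.const_mul (1 / (e * T a c))).of_shift hD fun x hx i hi =>
          ⟨belief_nonneg hT hL hμ₀ x i a θ, ?_⟩
        have hb := belief_nonneg hT hL hμ₀ x i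
        have hLx := hx (i + 1) (by omega) a
        have hm : 0 < evidence (L a) (belief T L μ₀ x i a) (x (i + 1) a) :=
          (mul_pos (hN x hx i hi a).1 hLx).trans_le (mul_le_evidence (hL a) (hb a) _ _)
        have h1 : belief T L μ₀ x i a θ * e ≤
            bayesUpdate (L a) (belief T L μ₀ x i a) (x (i + 1) a) θ := by
          rw [bayesUpdate_eq, le_div_iff₀ hm, ha]
          have h2 := evidence_le_one (hL a) (hb a) (hN x hx i hi a).2.le (x (i + 1) a)
          have h3 := heL a _ hLx
          have h4 := hb a θ
          have h5 : belief T L μ₀ x i a θ * e * evidence (L a) (belief T L μ₀ x i a)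
              (x (i + 1) a) ≤ belief T L μ₀ x i a θ * e :=
            mul_le_of_le_one_right (by positivity) h2
          exact h5.trans (mul_le_mul_of_nonneg_left h3 h4)
        have h2 : T a c * bayesUpdate (L a) (belief T L μ₀ x i a) (x (i + 1) a) θ ≤
            belief T L μ₀ x (i + 1) c θ := by
          rw [belief_succ]
          exact Finset.single_le_sum (f := fun a => T a c *
            bayesUpdate (L a) (belief T L μ₀ x i a) (x (i + 1) a) θ)
            (fun l _ => mul_nonneg (hnn l c) (bayesUpdate_nonneg (hL l) (hb l) _ _))
            (Finset.mem_univ a)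
        rw [one_div_mul_eq_div, le_div_iff₀ (by positivity)]
        calc _ = T a c * (belief T L μ₀ x i a θ * e) := by ring
          _ ≤ _ := (mul_le_mul_of_nonneg_left h1 hac.le).trans h2
      · exact hdist a θ ha
  -- The term `(1/4)^(i+1)` in `predictionLoss` serves here: it is a quarter of the square of the
  -- term `(1/2)^i` in the losses.
  have hgeom : SqControlled {x | IsTypical L θ₀ x} N D fun _ i => (1 / 2 : ℝ) ^ i := by
    refine ⟨4, 1, by norm_num, fun x hx i hi => ?_⟩
    have h1 : 0 ≤ ∑ k, π k * hellingerSq (L k (θ₀ k)) (evidence (L k) (belief T L μ₀ x i k)) :=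
      Finset.sum_nonneg fun k _ => mul_nonneg (hπ k).le (hellingerSq_nonneg _ _)
    have h2 : ((1 / 2 : ℝ) ^ i) ^ 2 = 4 * (1 / 4) ^ (i + 1) := by
      rw [← pow_mul, mul_comm i 2, pow_mul, pow_succ _ i, show (1 / 2 : ℝ) ^ 2 = 1 / 4 by norm_num]
      ring
    simp only [Finset.range_one, Finset.sum_singleton, add_zero, D, predictionLoss]
    linarith
  refine (hgeom.add hD (SqControlled.sum hD Finset.univ fun k _ => (SqControlled.sum hD
    (Finset.univ.erase (θ₀ k)) fun θ hθ => hwrong k θ (Finset.ne_of_mem_erase hθ)).const_mul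
      (π k))).of_le fun x hx i hi => ⟨(linLoss_pos hπ i fun k =>
        belief_le_one hT hL hμ₀ x i k _).le, le_of_eq ?_⟩
  simp only [linLoss]
  congr 1
  refine Finset.sum_congr rfl fun k _ => ?_
  rw [← (hN x hx i hi k).2, ← Finset.add_sum_erase _ _ (Finset.mem_univ (θ₀ k))]
  ring

end Sending

/-! ### Almost sure learning rates of the senders -/

section SendingLimit

variable {Ω K Θ : Type*} [Fintype K] [Fintype Θ] [DecidableEq K] [MeasurableSpace Ω]
  {P : Measure Ω} [IsProbabilityMeasure P]
  {Z : K → Type*} [∀ k, Fintype (Z k)] [∀ k, MeasurableSpace (Z k)]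
  [∀ k, MeasurableSingletonClass (Z k)]
  {T : Matrix K K ℝ} {L : ∀ k, Θ → Z k → ℝ} {μ₀ : K → Θ → ℝ} {θ₀ : K → Θ}
  {ξ : ℕ → Ω → ∀ k, Z k}

/-- By concavity, the γ-th power of the loss divided by γ lies below its tangent, of slope
`logLoss^(γ-1)`, so its expected decrease is at least that slope times the prediction loss. The case
γ = 1 gives convergence; smaller γ gives a rate, because the slope is large when the loss is small.
-/
lemma ae_summable_predictionLoss (hξ : IsSignalProcess P L θ₀ ξ)
    (hT : T ∈ Matrix.colStochastic ℝ K) (hL : ∀ k θ, IsProbVec (L k θ))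
    (hμ₀ : ∀ k, IsProbVec (μ₀ k)) (hθ : ∀ l k, 0 < T l k → θ₀ l = θ₀ k)
    {π : K → ℝ} (hπ : ∀ k, 0 < π k) (hfix : ∀ l, ∑ k, T l k * π k = π l) {N : ℕ}
    (hN : ∀ x, IsTypical L θ₀ x → ∀ i, N ≤ i → ∀ k, 0 < belief T L μ₀ x i k (θ₀ k))
    {γ : ℝ} (hγ0 : 0 < γ) (hγ1 : γ ≤ 1) :
    ∀ᵐ ω ∂P, Summable fun i =>
      logLoss π θ₀ (belief T L μ₀ (fun j => ξ j ω) i) i ^ (γ - 1) *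
        predictionLoss π L θ₀ (belief T L μ₀ (fun j => ξ j ω) i) i := by
  have hdep : ∀ {β : Type} (i : ℕ) (f : (K → Θ → ℝ) → β),
      DependsOn (fun x => f (belief T L μ₀ x i)) (Set.Icc 1 i) := by
    intro β i f x y hxy
    have := belief_dependsOn T L μ₀ (le_refl i) hxy
    simp only at this
    simp only [this]
  refine hξ.ae_summable_of_drift hL N
    (Y := fun i x => logLoss π θ₀ (belief T L μ₀ x i) i ^ γ / γ)
    (C := fun i x => logLoss π θ₀ (belief T L μ₀ x i) i ^ γ / γ -
      logLoss π θ₀ (belief T L μ₀ x i) i ^ (γ - 1) * (1 / 4) ^ (i + 1))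
    (D := fun i x => logLoss π θ₀ (belief T L μ₀ x i) i ^ (γ - 1) *
      predictionLoss π L θ₀ (belief T L μ₀ x i) i)
    (H := fun i l ζ x => -(logLoss π θ₀ (belief T L μ₀ x i) i ^ (γ - 1) * (π l *
      (2 * (1 - √(evidence (L l) (belief T L μ₀ x i l) ζ / L l (θ₀ l) ζ))))))
    (fun i => hdep i fun b => logLoss π θ₀ b i ^ γ / γ)
    (fun i => hdep i fun b => logLoss π θ₀ b i ^ γ / γ -
      logLoss π θ₀ b i ^ (γ - 1) * (1 / 4) ^ (i + 1))
    (fun i => hdep i fun b => logLoss π θ₀ b i ^ (γ - 1) * predictionLoss π L θ₀ b i)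
    (fun i l ζ => hdep i fun b => -(logLoss π θ₀ b i ^ (γ - 1) * (π l *
      (2 * (1 - √(evidence (L l) (b l) ζ / L l (θ₀ l) ζ))))))
    ?_ ?_ ?_ ?_
  · intro x hx i hi
    have := logLoss_pos hπ (i := i) (hN x hx i hi) fun k => belief_le_one hT hL hμ₀ x i k _
    positivity
  · intro x hx i hi
    have := logLoss_pos hπ (i := i) (hN x hx i hi) fun k => belief_le_one hT hL hμ₀ x i k _
    exact mul_nonneg (by positivity) (predictionLoss_nonneg hπ _ _)
  · intro x hx i hi
    have h1 := logLoss_pos hπ (i := i) (hN x hx i hi) fun k => belief_le_one hT hL hμ₀ x i k _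
    have h2 := logLoss_pos hπ (i := i + 1) (hN x hx (i + 1) (by omega))
      fun k => belief_le_one hT hL hμ₀ x (i + 1) k _
    have h3 := rpow_le_tangent hγ0.le hγ1 h1 h2.le
    have h4 := logLoss_succ_le hT hL hμ₀ hθ hπ hfix hx (hN x hx i hi)
    simp only [Finset.sum_neg_distrib, ← Finset.mul_sum]
    have h5 : 0 ≤ γ * logLoss π θ₀ (belief T L μ₀ x i) i ^ (γ - 1) := by positivity
    have h6 := mul_le_mul_of_nonneg_left (sub_le_sub_right h4
      (logLoss π θ₀ (belief T L μ₀ x i) i)) h5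
    rw [div_le_iff₀ hγ0]
    refine (h3.trans (add_le_add_right h6 _)).trans (le_of_eq ?_)
    field_simp
    ring_nf
  · intro x hx i hi
    have h1 := logLoss_pos hπ (i := i) (hN x hx i hi) fun k => belief_le_one hT hL hμ₀ x i k _
    have h2 : ∀ l, ∑ ζ, L l (θ₀ l) ζ * -(logLoss π θ₀ (belief T L μ₀ x i) i ^ (γ - 1) * (π l *
        (2 * (1 - √(evidence (L l) (belief T L μ₀ x i l) ζ / L l (θ₀ l) ζ))))) ≤
        - (logLoss π θ₀ (belief T L μ₀ x i) i ^ (γ - 1) *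
          (π l * hellingerSq (L l (θ₀ l)) (evidence (L l) (belief T L μ₀ x i l)))) := by
      intro l
      have h3 := hellingerSq_le (hL l (θ₀ l)).1 (hL l (θ₀ l)).2
        (evidence_nonneg (hL l) (belief_nonneg hT hL hμ₀ x i l))
        ((sum_evidence (hL l) _).trans_le (sum_belief_le_one hT hμ₀ x i l))
      have h4 : 0 ≤ logLoss π θ₀ (belief T L μ₀ x i) i ^ (γ - 1) * π l :=
        mul_nonneg (by positivity) (hπ l).le
      have h5 := mul_le_mul_of_nonneg_left h3 h4
      rw [Finset.mul_sum] at h5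
      have h6 : ∀ ζ, L l (θ₀ l) ζ * -(logLoss π θ₀ (belief T L μ₀ x i) i ^ (γ - 1) * (π l *
        (2 * (1 - √(evidence (L l) (belief T L μ₀ x i l) ζ / L l (θ₀ l) ζ))))) =
        -(logLoss π θ₀ (belief T L μ₀ x i) i ^ (γ - 1) * π l * (L l (θ₀ l) ζ *
        (2 * (1 - √(evidence (L l) (belief T L μ₀ x i l) ζ / L l (θ₀ l) ζ))))) :=
        fun ζ => by ring
      simp only [h6, Finset.sum_neg_distrib]
      linarith
    have h3 := Finset.sum_le_sum fun l (_ : l ∈ Finset.univ) => h2 l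
    refine (add_le_add_right h3 _).trans (le_of_eq ?_)
    simp only [Finset.sum_neg_distrib, ← Finset.mul_sum, predictionLoss]
    ring

/-- In the sending sub-networks the beliefs in the wrong states tend to zero almost surely, and
their powers with exponent `1 + γ` are summable for every `γ > 0`. -/
lemma ae_summable_rpow_wrong_belief (hξ : IsSignalProcess P L θ₀ ξ)
    (hT : T ∈ Matrix.colStochastic ℝ K) (hL : ∀ k θ, IsProbVec (L k θ))
    (hμ₀ : ∀ k, IsProbVec (μ₀ k)) (hθ : ∀ l k, 0 < T l k → θ₀ l = θ₀ k)
    {π : K → ℝ} (hπ : ∀ k, 0 < π k) (hfix : ∀ l, ∑ k, T l k * π k = π l)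
    (hreach : ∀ k, ∃ k₀ h, Relation.ReflTransGen (fun a b => 0 < T a b) k₀ h ∧
      Relation.ReflTransGen (fun a b => 0 < T a b) h k ∧ 0 < T h h ∧ 0 < μ₀ k₀ (θ₀ k₀))
    (hprev : ∀ k, ∃ ζ, IsPrevailing (L k) (θ₀ k) ζ)
    (hident : ∀ k θ, θ ≠ θ₀ k → ∃ l, Relation.ReflTransGen (fun a b => 0 < T a b) k l ∧
      θ ∉ indistinguishable (L l) (θ₀ l)) {γ : ℝ} (hγ0 : 0 < γ) (hγ1 : γ ≤ 1) :
    ∀ᵐ ω ∂P, Summable fun i =>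
      (∑ k, (1 - belief T L μ₀ (fun j => ξ j ω) i k (θ₀ k))) ^ (1 + γ) := by
  obtain ⟨N, hN⟩ := exists_forall_belief_pos hT hL hμ₀ hθ hreach
  have hctrl := sqControlled_linLoss hT hL hμ₀ hπ hprev hident hN
  obtain ⟨c, hc, hc1, hcL⟩ := exists_lower_bound L θ₀
  have h1 := ae_summable_predictionLoss hξ hT hL hμ₀ hθ hπ hfix
    (fun x hx i hi k => (hN x hx i hi k).1) one_pos le_rfl
  have h2 := ae_summable_predictionLoss hξ hT hL hμ₀ hθ hπ hfix
    (fun x hx i hi k => (hN x hx i hi k).1) hγ0 hγ1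
  filter_upwards [hξ.ae_isTypical, h1, h2] with ω hω hs1 hs2
  set x : ℕ → ∀ k, Z k := fun j => ξ j ω
  have hb1 : ∀ i k, belief T L μ₀ x i k (θ₀ k) ≤ 1 := fun i k => belief_le_one hT hL hμ₀ x i k _
  simp only [sub_self, Real.rpow_zero, one_mul] at hs1
  have hlim := hctrl.tendsto_zero hω hs1
  -- The case γ = 1 is used first, to reach the region where the two losses are comparable; only
  -- then does the drift with exponent γ yield the rate.
  have hhalf : ∀ᶠ i in atTop, ∀ k, 1 / 2 ≤ belief T L μ₀ x i k (θ₀ k) := by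
    rw [eventually_all]
    intro k
    have hpk := hπ k
    filter_upwards [hlim.eventually_lt_const (show 0 < π k * (1 / 2) by positivity)] with i hi
    have h3 := mul_one_sub_le_linLoss hπ i (hb1 i) k
    have h4 := lt_of_mul_lt_mul_left (h3.trans_lt hi) hpk.le
    linarith
  obtain ⟨M, hM⟩ := eventually_atTop.1 hhalf
  obtain ⟨C, n, hC, hsq⟩ := hctrl
  have hsum := summable_rpow_of_sq_le (M := max M N) (B := 2 / c) hγ1
    (by rw [le_div_iff₀ hc]; linarith) hC
    (fun i => predictionLoss_nonneg hπ (belief T L μ₀ x i) i)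
    (fun i _ => linLoss_pos hπ i (hb1 i))
    (fun i hi => linLoss_le_logLoss hπ fun k => (hN x hω i (le_of_max_le_right hi) k).1)
    (fun i hi => logLoss_le_linLoss hπ (hM i (le_of_max_le_left hi)) (hb1 i))
    (fun i _ => linLoss_succ_le hT hL hμ₀ hθ hπ hfix hc hc1 hcL hω i)
    (fun i hi => hsq x hω i (le_of_max_le_right hi)) hs2
  have hnn : ∀ i, 0 ≤ ∑ k, (1 - belief T L μ₀ x i k (θ₀ k)) := fun i =>
    Finset.sum_nonneg fun k _ => sub_nonneg.2 (hb1 i k)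
  have hC' : 0 ≤ ∑ k, 1 / π k := Finset.sum_nonneg fun k _ => (one_div_pos.2 (hπ k)).le
  refine Summable.of_nonneg_of_le (fun i => Real.rpow_nonneg (hnn i) _) (fun i => ?_)
    (hsum.mul_left ((∑ k, 1 / π k) ^ (1 + γ)))
  rw [← Real.mul_rpow hC' (linLoss_pos hπ i (hb1 i)).le]
  refine Real.rpow_le_rpow (hnn i) ?_ (by linarith)
  rw [Finset.sum_mul]
  refine Finset.sum_le_sum fun k _ => ?_
  rw [one_div_mul_eq_div, le_div_iff₀' (hπ k)]
  exact mul_one_sub_le_linLoss hπ i (hb1 i) k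

end SendingLimit

/-! ### Convergence in the receiving sub-networks -/

lemma tendsto_zero_of_le_mul_add {x η : ℕ → ℝ} {ρ : ℝ} (hρ0 : 0 ≤ ρ) (hρ1 : ρ < 1)
    (hx : ∀ i, 0 ≤ x i) (hη : Tendsto η atTop (𝓝 0)) (h : ∀ i, x (i + 1) ≤ ρ * x i + η i) :
    Tendsto x atTop (𝓝 0) := by
  rw [Metric.tendsto_atTop]
  intro ε hε
  have hδ : 0 < (1 - ρ) * (ε / 2) := mul_pos (by linarith) (by linarith)
  obtain ⟨M, hM⟩ := eventually_atTop.1 (hη.eventually_lt_const hδ)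
  have hbound : ∀ n, x (M + n) ≤ ρ ^ n * x M + ε / 2 := by
    intro n
    induction n with
    | zero => simp; linarith
    | succ n ih =>
      have h1 := h (M + n)
      have h2 := hM (M + n) (by omega)
      have h3 := mul_le_mul_of_nonneg_left ih hρ0
      rw [pow_succ, show M + (n + 1) = M + n + 1 by ring]
      linarith
  have hgeo : Tendsto (fun n => ρ ^ n * x M) atTop (𝓝 0) := by
    simpa using (tendsto_pow_atTop_nhds_zero_of_lt_one hρ0 hρ1).mul_const (x M)
  obtain ⟨n₀, hn₀⟩ := eventually_atTop.1 (hgeo.eventually_lt_const (show 0 < ε / 2 by linarith))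
  refine ⟨M + n₀, fun i hi => ?_⟩
  obtain ⟨n, rfl⟩ : ∃ n, i = M + n := ⟨i - M, by omega⟩
  rw [Real.dist_0_eq_abs, abs_of_nonneg (hx _)]
  linarith [hbound n, hn₀ n (by omega)]

/-- As γ tends to 0, `B ^ γ` tends to 1: a small excess over exponent one does not spoil the
contraction, whatever the worst-case growth `B`. -/
lemma exists_exponent {B ρ : ℝ} (hB : 0 < B) (hρ : ρ < 1) :
    ∃ γ : ℝ, 0 < γ ∧ γ ≤ 1 ∧ B ^ γ * ρ < 1 := by
  have h1 : Tendsto (fun γ : ℝ => B ^ γ * ρ) (𝓝 0) (𝓝 (B ^ (0 : ℝ) * ρ)) :=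
    ((Real.continuousAt_const_rpow hB.ne').tendsto).mul_const ρ
  rw [Real.rpow_zero, one_mul] at h1
  have h2 : ∀ᶠ γ in 𝓝[>] (0 : ℝ), B ^ γ * ρ < 1 :=
    (h1.eventually_lt_const hρ).filter_mono nhdsWithin_le_nhds
  obtain ⟨γ, h3, h4⟩ := (h2.and (Ioc_mem_nhdsGT one_pos)).exists
  exact ⟨γ, h4.1, h4.2, h3⟩

/-- Convexity of the power with weights `ρ` and `1 - ρ` at the points `X` and `a e / (1 - ρ)`; this
keeps the factor `ρ` in front of `X ^ β`. -/
lemma rpow_mul_add_le {ρ a β X e : ℝ} (hρ0 : 0 < ρ) (hρ1 : ρ < 1) (ha : 0 ≤ a) (hβ : 1 ≤ β)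
    (hX : 0 ≤ X) (he : 0 ≤ e) :
    (ρ * X + a * e) ^ β ≤ ρ * X ^ β + (1 - ρ) * (a / (1 - ρ)) ^ β * e ^ β := by
  have h1 : 0 < 1 - ρ := by linarith
  have h := (convexOn_rpow hβ).2 (x := X) (y := a / (1 - ρ) * e) hX
    (by simp only [Set.mem_Ici]; positivity) hρ0.le h1.le (by ring)
  simp only [smul_eq_mul] at h
  rw [Real.mul_rpow (by positivity) he] at h
  have e1 : ρ * X + (1 - ρ) * (a / (1 - ρ) * e) = ρ * X + a * e := by field_simp
  rw [e1] at h
  linarith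

section Receiving

variable {𝒮 𝓡 Θ : Type*} [Fintype 𝒮] [Fintype 𝓡] [Fintype Θ]
  [DecidableEq 𝒮] [DecidableEq 𝓡] {S R : ℕ} {netS : 𝒮 → Fin S} {netR : 𝓡 → Fin R}
  {A : Matrix (𝒮 ⊕ 𝓡) (𝒮 ⊕ 𝓡) ℝ} {Z : 𝒮 ⊕ 𝓡 → Type*}
  {L : ∀ k, Θ → Z k → ℝ} {μ₀ : 𝒮 ⊕ 𝓡 → Θ → ℝ} {θ₀ : 𝒮 ⊕ 𝓡 → Θ} {E : 𝒮 ⊕ 𝓡 → Finset Θ}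

/-- The part of the belief of agent `k` that is not assigned to the states in `E k`. -/
def strayBelief {K Θ : Type*} (E : K → Finset Θ) (b : K → Θ → ℝ) (k : K) : ℝ :=
  1 - ∑ θ ∈ E k, b k θ

/-- The weighted sum of the stray beliefs of the receiving agents. -/
def recvStray (w : 𝓡 → ℝ) (E : 𝒮 ⊕ 𝓡 → Finset Θ) (b : 𝒮 ⊕ 𝓡 → Θ → ℝ) : ℝ :=
  ∑ k, w k * strayBelief E b (Sum.inr k)

/-- The sum of the stray beliefs of the sending agents. -/
def sendStray (E : 𝒮 ⊕ 𝓡 → Finset Θ) (b : 𝒮 ⊕ 𝓡 → Θ → ℝ) : ℝ :=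
  ∑ k, strayBelief E b (Sum.inl k)

/-- A state that is not stray for `l` is not stray for any receiver of its data. The bound is a sum
of terms each depending on one agent's new signal, as `IsSignalProcess.ae_summable_of_drift`
requires. -/
lemma recvStray_succ_le [∀ k, Fintype (Z k)] (hA : IsWeaklyConnected netS netR A)
    (hL : ∀ k θ, IsProbVec (L k θ)) (hμ₀ : ∀ k, IsProbVec (μ₀ k))
    (hE : ∀ l (k : 𝓡), E l ⊆ E (Sum.inr k)) {w : 𝓡 → ℝ} (hw : ∀ k, 1 ≤ w k)
    (x : ℕ → ∀ k, Z k) (i : ℕ) :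
    recvStray w E (belief A L μ₀ x (i + 1)) ≤ ∑ l, (∑ k, A l (Sum.inr k) * w k) *
      (1 - ∑ θ ∈ E l, bayesUpdate (L l) (belief A L μ₀ x i l) (x (i + 1) l) θ) := by
  have h1 : ∀ k : 𝓡, strayBelief E (belief A L μ₀ x (i + 1)) (Sum.inr k) ≤
      ∑ l, A l (Sum.inr k) *
        (1 - ∑ θ ∈ E l, bayesUpdate (L l) (belief A L μ₀ x i l) (x (i + 1) l) θ) := by
    intro k
    rw [strayBelief, one_sub_sum_belief_succ hA.leftStochastic]
    refine Finset.sum_le_sum fun l _ => mul_le_mul_of_nonneg_left ?_ (hA.nonneg _ _)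
    exact sub_le_sub_left (Finset.sum_le_sum_of_subset_of_nonneg (hE l k) fun θ _ _ =>
      bayesUpdate_nonneg (hL l) (belief_nonneg hA.leftStochastic hL hμ₀ x i l) _ _) 1
  refine (Finset.sum_le_sum fun k _ => mul_le_mul_of_nonneg_left (h1 k)
    (zero_le_one.trans (hw k))).trans (le_of_eq ?_)
  simp only [Finset.mul_sum, Finset.sum_mul]
  rw [Finset.sum_comm]
  exact Finset.sum_congr rfl fun _ _ => Finset.sum_congr rfl fun _ _ => by ring

lemma sum_weight_mul_le (hA : IsWeaklyConnected netS netR A) {w : 𝓡 → ℝ} {ρ : ℝ}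
    (hw : ∀ k, 1 ≤ w k) (hρ : ∀ l, ∑ k, A (Sum.inr l) (Sum.inr k) * w k ≤ ρ * w l)
    {q : 𝒮 ⊕ 𝓡 → ℝ} (hq : ∀ k, 0 ≤ q k) :
    ∑ l, (∑ k, A l (Sum.inr k) * w k) * q l ≤
      ρ * ∑ k, w k * q (Sum.inr k) + (∑ k, w k) * ∑ k, q (Sum.inl k) := by
  rw [Fintype.sum_sum_type, add_comm, Finset.mul_sum, Finset.mul_sum]
  refine add_le_add (Finset.sum_le_sum fun l _ => ?_) (Finset.sum_le_sum fun l _ => ?_)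
  · rw [← mul_assoc]
    exact mul_le_mul_of_nonneg_right (hρ l) (hq _)
  · refine mul_le_mul_of_nonneg_right (Finset.sum_le_sum fun k _ => ?_) (hq _)
    exact mul_le_of_le_one_left (zero_le_one.trans (hw k))
      (Matrix.le_one_of_mem_colStochastic hA.leftStochastic)

lemma strayBelief_nonneg [∀ k, Fintype (Z k)] (hA : IsWeaklyConnected netS netR A)
    (hL : ∀ k θ, IsProbVec (L k θ)) (hμ₀ : ∀ k, IsProbVec (μ₀ k)) (E : 𝒮 ⊕ 𝓡 → Finset Θ)
    (x : ℕ → ∀ k, Z k) (i : ℕ) (k : 𝒮 ⊕ 𝓡) : 0 ≤ strayBelief E (belief A L μ₀ x i) k :=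
  one_sub_sum_nonneg (belief_nonneg hA.leftStochastic hL hμ₀ x i k)
    (sum_belief_le_one hA.leftStochastic hμ₀ x i k) _

/-- The input `C t`, discounted by `(s + t)²`, is at most `C / s - C / (s + t)` and so telescopes.
The discount is needed because the inputs are summable only almost surely, not in expectation. -/
lemma discount_inequality {a X X' t s C : ℝ} (ha : 0 ≤ a) (hX : 0 ≤ X) (ht : 0 ≤ t) (hs : 0 < s)
    (hC : 0 ≤ C) (h : X' ≤ a * X + C * t) :
    C / (s + t) + X' / (s + t) ^ 2 ≤ X / s ^ 2 + C / s - (1 - a) * X / s ^ 2 := by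
  have hst : 0 < s + t := by linarith
  have h1 : X' / (s + t) ^ 2 ≤ (a * X + C * t) / (s + t) ^ 2 := by gcongr
  have h2 : a * X / (s + t) ^ 2 ≤ a * X / s ^ 2 := by gcongr; linarith
  have h3 : C * t / (s + t) ^ 2 ≤ C * t / (s * (s + t)) := by
    rw [pow_two]; gcongr; linarith
  have h4 : C / s - C / (s + t) = C * t / (s * (s + t)) := by field_simp; ring
  have h5 : X / s ^ 2 - (1 - a) * X / s ^ 2 = a * X / s ^ 2 := by ring
  rw [add_div] at h1
  linarith

/-- If the stray beliefs of the sending agents have summable powers with all exponents above one,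
then the stray beliefs of the receiving agents tend to zero almost surely. -/
lemma ae_tendsto_recvStray {Ω : Type*} [MeasurableSpace Ω] {P : Measure Ω}
    [IsProbabilityMeasure P] [∀ k, Fintype (Z k)] [∀ k, MeasurableSpace (Z k)]
    [∀ k, MeasurableSingletonClass (Z k)] {ξ : ℕ → Ω → ∀ k, Z k}
    (hA : IsWeaklyConnected netS netR A) (hL : ∀ k θ, IsProbVec (L k θ))
    (hμ₀ : ∀ k, IsProbVec (μ₀ k)) (hξ : IsSignalProcess P L θ₀ ξ)
    (hE : ∀ l (k : 𝓡), E l ⊆ E (Sum.inr k))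
    (hEL : ∀ k, ∀ θ ∈ E k, ∀ ζ, L k θ ζ = L k (θ₀ k) ζ)
    (hsend : ∀ γ : ℝ, 0 < γ → γ ≤ 1 → ∀ᵐ ω ∂P,
      Summable fun i => sendStray E (belief A L μ₀ (fun j => ξ j ω) i) ^ (1 + γ))
    {w : 𝓡 → ℝ} {ρ : ℝ} (hw : ∀ k, 1 ≤ w k) (hρ0 : 0 < ρ) (hρ1 : ρ < 1)
    (hρ : ∀ l, ∑ k, A (Sum.inr l) (Sum.inr k) * w k ≤ ρ * w l) :
    ∀ᵐ ω ∂P, Tendsto (fun i => recvStray w E (belief A L μ₀ (fun j => ξ j ω) i)) atTop (𝓝 0) := by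
  obtain ⟨c, hc, hc1, hcL⟩ := exists_lower_bound L θ₀
  set B : ℝ := 2 / c
  have hB : 0 < B := by positivity
  obtain ⟨γ, hγ0, hγ1, hBρ⟩ := exists_exponent hB hρ1
  set Q : (𝒮 ⊕ 𝓡 → Θ → ℝ) → ℝ := recvStray w E
  set ε : (𝒮 ⊕ 𝓡 → Θ → ℝ) → ℝ := sendStray E
  set b : (ℕ → ∀ k, Z k) → ℕ → 𝒮 ⊕ 𝓡 → Θ → ℝ := fun x i => belief A L μ₀ x i with hb
  set v : 𝒮 ⊕ 𝓡 → ℝ := fun l => ∑ k, A l (Sum.inr k) * w k with hv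
  set a : ℝ := ∑ k, w k with ha
  have hw0 : ∀ k, 0 ≤ w k := fun k => zero_le_one.trans (hw k)
  have ha0 : 0 ≤ a := Finset.sum_nonneg fun k _ => hw0 k
  have hv0 : ∀ l, 0 ≤ v l := fun l =>
    Finset.sum_nonneg fun k _ => mul_nonneg (hA.nonneg _ _) (hw0 k)
  have hq : ∀ x i k, 0 ≤ strayBelief E (b x i) k := fun x i k =>
    strayBelief_nonneg hA hL hμ₀ E x i k
  have hQ0 : ∀ x i, 0 ≤ Q (b x i) := fun x i =>
    Finset.sum_nonneg fun k _ => mul_nonneg (hw0 k) (hq x i _)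
  have hε0 : ∀ x i, 0 ≤ ε (b x i) := fun x i => Finset.sum_nonneg fun k _ => hq x i _
  set F : (𝒮 ⊕ 𝓡 → Θ → ℝ) → ℝ := fun b => ρ * Q b + a * ε b with hF
  have hF0 : ∀ x i, 0 ≤ F (b x i) := fun x i =>
    add_nonneg (mul_nonneg hρ0.le (hQ0 x i)) (mul_nonneg ha0 (hε0 x i))
  have hvF : ∀ x i, ∑ l, v l * strayBelief E (b x i) l ≤ F (b x i) := fun x i =>
    sum_weight_mul_le hA hw hρ (hq x i)
  set U : (ℕ → ∀ k, Z k) → ℕ → ℝ := fun x i => 1 + ∑ j ∈ Finset.range i, ε (b x j) ^ (1 + γ) with hU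
  have hU1 : ∀ x i, 1 ≤ U x i := fun x i => le_add_of_nonneg_right
    (Finset.sum_nonneg fun j _ => Real.rpow_nonneg (hε0 x j) _)
  have hUsucc : ∀ x i, U x (i + 1) = U x i + ε (b x i) ^ (1 + γ) := fun x i => by
    simp only [hU, Finset.sum_range_succ, add_assoc]
  set C₁ : ℝ := B ^ γ * ((1 - ρ) * (a / (1 - ρ)) ^ (1 + γ)) with hC₁
  have hρ' : 0 < 1 - ρ := by linarith
  have hC₁0 : 0 ≤ C₁ := by positivity
  have hbd : ∀ i j, j ≤ i → ∀ x y : ℕ → ∀ k, Z k, (∀ n ∈ Set.Icc 1 i, x n = y n) →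
      b x j = b y j := fun i j hji x y hxy => belief_dependsOn A L μ₀ hji hxy
  -- `U` is predictable: `U x (i + 1)` is already determined by the signals up to time `i`, so it
  -- may appear in `C` and `H` below.
  have hUd : ∀ i j, j ≤ i + 1 → ∀ x y : ℕ → ∀ k, Z k, (∀ n ∈ Set.Icc 1 i, x n = y n) →
      U x j = U y j := by
    intro i j hji x y hxy
    simp only [hU]
    congr 1
    refine Finset.sum_congr rfl fun n hn => ?_
    rw [hbd i n (by have := Finset.mem_range.1 hn; omega) x y hxy]
  have hstepQ : ∀ x, IsTypical L θ₀ x → ∀ i, Q (b x (i + 1)) ≤ B * F (b x i) := by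
    intro x hx i
    refine (recvStray_succ_le hA hL hμ₀ hE hw x i).trans ?_
    refine le_trans ?_ (mul_le_mul_of_nonneg_left (hvF x i) hB.le)
    rw [Finset.mul_sum]
    refine Finset.sum_le_sum fun l _ => ?_
    have := one_sub_sum_bayesUpdate_le (hL l)
      (belief_nonneg hA.leftStochastic hL hμ₀ x i l)
      (sum_belief_le_one hA.leftStochastic hμ₀ x i l) (hEL l) hc hc1
      (hcL l _ (hx (i + 1) (by omega) l))
    calc _ ≤ v l * (B * strayBelief E (b x i) l) := mul_le_mul_of_nonneg_left this (hv0 l)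
      _ = _ := by ring
  have hdrift := hξ.ae_summable_of_drift hL 0
    (Y := fun i x => Q (b x i) ^ (1 + γ) / U x i ^ 2 + C₁ / U x i)
    (C := fun i x => C₁ / U x (i + 1))
    (D := fun i x => (1 - B ^ γ * ρ) * Q (b x i) ^ (1 + γ) / U x i ^ 2)
    (H := fun i l ζ x => v l * (1 - ∑ θ ∈ E l, bayesUpdate (L l) (b x i l) ζ θ) *
      ((B * F (b x i)) ^ γ / U x (i + 1) ^ 2))
    (fun i x y hxy => by
      simp only [hbd i i le_rfl x y hxy, hUd i i (by omega) x y hxy])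
    (fun i x y hxy => by simp only [hUd i (i + 1) le_rfl x y hxy])
    (fun i x y hxy => by
      simp only [hbd i i le_rfl x y hxy, hUd i i (by omega) x y hxy])
    (fun i l ζ x y hxy => by
      simp only [hbd i i le_rfl x y hxy, hUd i (i + 1) le_rfl x y hxy])
    (fun x _ i _ => by
      have := hU1 x i
      have := hQ0 x i
      positivity)
    (fun x _ i _ => by
      have h1 := hU1 x i
      have h2 := hQ0 x i
      have h3 : 0 ≤ 1 - B ^ γ * ρ := by linarith
      positivity)
    (fun x hx i _ => by
      have h1 := hQ0 x (i + 1)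
      have h2 := recvStray_succ_le hA hL hμ₀ hE hw x i
      have h3 := Real.rpow_le_rpow h1 (hstepQ x hx i) hγ0.le
      -- Of `Q^(1+γ) = Q · Q^γ` only the second factor is replaced by its worst case, known at time
      -- `i`; the first stays additive over the agents, so marginal laws suffice to average it.
      have h4 : Q (b x (i + 1)) ^ (1 + γ) ≤ (∑ l, v l *
          (1 - ∑ θ ∈ E l, bayesUpdate (L l) (b x i l) (x (i + 1) l) θ)) *
          (B * F (b x i)) ^ γ := by
        rw [Real.rpow_one_add' h1 (by linarith)]
        exact mul_le_mul h2 h3 (Real.rpow_nonneg h1 _) (h1.trans h2)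
      rw [← Finset.sum_mul, add_comm, mul_div_assoc']
      gcongr)
    (fun x hx i _ => by
      have h1 : ∀ l, ∑ ζ, L l (θ₀ l) ζ * (v l * (1 - ∑ θ ∈ E l, bayesUpdate (L l) (b x i l) ζ θ) *
          ((B * F (b x i)) ^ γ / U x (i + 1) ^ 2)) ≤
          v l * strayBelief E (b x i) l * ((B * F (b x i)) ^ γ / U x (i + 1) ^ 2) := by
        intro l
        have h2 := sum_mul_one_sub_bayesUpdate_le (hL l)
          (belief_nonneg hA.leftStochastic hL hμ₀ x i l)
          (sum_belief_le_one hA.leftStochastic hμ₀ x i l) (hEL l) (hL l (θ₀ l))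
        have h3 : 0 ≤ (B * F (b x i)) ^ γ / U x (i + 1) ^ 2 :=
          div_nonneg (Real.rpow_nonneg (mul_nonneg hB.le (hF0 x i)) _) (sq_nonneg _)
        calc _ = v l * (∑ ζ, L l (θ₀ l) ζ * (1 - ∑ θ ∈ E l, bayesUpdate (L l) (b x i l) ζ θ)) *
              ((B * F (b x i)) ^ γ / U x (i + 1) ^ 2) := by
              rw [Finset.mul_sum, Finset.sum_mul]
              exact Finset.sum_congr rfl fun ζ _ => by ring
          _ ≤ _ := mul_le_mul_of_nonneg_right (mul_le_mul_of_nonneg_left h2 (hv0 l)) h3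
      have h2 := Finset.sum_le_sum fun l (_ : l ∈ Finset.univ) => h1 l
      rw [← Finset.sum_mul] at h2
      have hBF : 0 ≤ (B * F (b x i)) ^ γ := Real.rpow_nonneg (mul_nonneg hB.le (hF0 x i)) _
      have h3 : (∑ l, v l * strayBelief E (b x i) l) * ((B * F (b x i)) ^ γ / U x (i + 1) ^ 2) ≤
          F (b x i) * (B * F (b x i)) ^ γ / U x (i + 1) ^ 2 := by
        rw [mul_div_assoc]
        exact mul_le_mul_of_nonneg_right (hvF x i) (div_nonneg hBF (sq_nonneg _))
      have h4 : F (b x i) * (B * F (b x i)) ^ γ ≤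
          B ^ γ * ρ * Q (b x i) ^ (1 + γ) + C₁ * ε (b x i) ^ (1 + γ) := by
        have h5 := rpow_mul_add_le (β := 1 + γ) hρ0 hρ1 ha0 (by linarith) (hQ0 x i) (hε0 x i)
        rw [Real.mul_rpow hB.le (hF0 x i)]
        have h6 : F (b x i) * (B ^ γ * F (b x i) ^ γ) = B ^ γ * F (b x i) ^ (1 + γ) := by
          rw [Real.rpow_one_add' (hF0 x i) (by linarith)]
          ring
        rw [h6]
        have h7 := mul_le_mul_of_nonneg_left h5 (Real.rpow_nonneg hB.le γ)
        simp only [hC₁, hF]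
        linarith
      have h5 := discount_inequality (mul_nonneg (Real.rpow_nonneg hB.le γ) hρ0.le)
        (Real.rpow_nonneg (hQ0 x i) (1 + γ)) (Real.rpow_nonneg (hε0 x i) (1 + γ))
        (zero_lt_one.trans_le (hU1 x i)) hC₁0 h4
      rw [← hUsucc] at h5
      exact (add_le_add_right (h2.trans h3) _).trans h5)
  filter_upwards [hdrift, hsend γ hγ0 hγ1] with ω hD hs
  set x : ℕ → ∀ k, Z k := fun j => ξ j ω
  -- On this path the discount is bounded, so it can be removed.
  have hUle : ∀ i, U x i ≤ 1 + ∑' j, ε (b x j) ^ (1 + γ) := fun i =>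
    add_le_add_right (hs.sum_le_tsum _ fun j _ => Real.rpow_nonneg (hε0 x j) _) 1
  set V : ℝ := 1 + ∑' j, ε (b x j) ^ (1 + γ)
  have hκ : 0 < 1 - B ^ γ * ρ := by linarith
  have h1 : Tendsto (fun i => V ^ 2 / (1 - B ^ γ * ρ) *
      ((1 - B ^ γ * ρ) * Q (b x i) ^ (1 + γ) / U x i ^ 2)) atTop (𝓝 0) := by
    simpa using hD.tendsto_atTop_zero.const_mul (V ^ 2 / (1 - B ^ γ * ρ))
  have h2 : Tendsto (fun i => Q (b x i) ^ (1 + γ)) atTop (𝓝 0) := by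
    refine squeeze_zero (fun i => Real.rpow_nonneg (hQ0 x i) _) (fun i => ?_) h1
    have hU0 : 0 < U x i := zero_lt_one.trans_le (hU1 x i)
    have h3 : V ^ 2 / (1 - B ^ γ * ρ) * ((1 - B ^ γ * ρ) * Q (b x i) ^ (1 + γ) / U x i ^ 2) =
        Q (b x i) ^ (1 + γ) * (V ^ 2 / U x i ^ 2) := by field_simp
    rw [h3]
    refine le_mul_of_one_le_right (Real.rpow_nonneg (hQ0 x i) _) ?_
    rw [one_le_div (by positivity)]
    exact pow_le_pow_left₀ hU0.le (hUle i) 2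
  have h3 := h2.rpow_const (p := (1 + γ)⁻¹) (Or.inr (by positivity))
  rw [Real.zero_rpow (by positivity)] at h3
  refine h3.congr fun i => ?_
  exact Real.rpow_rpow_inv (hQ0 x i) (by linarith)

/-- If all stray beliefs tend to zero along a typical path, then the beliefs of the receiving
agents at `θ` tend to the averages, with weights `influence A`, of the limits of the sending
agents. -/
lemma tendsto_belief_recv [∀ k, Fintype (Z k)] (hA : IsWeaklyConnected netS netR A)
    (hL : ∀ k θ, IsProbVec (L k θ)) (hμ₀ : ∀ k, IsProbVec (μ₀ k))
    (hEL : ∀ k, ∀ θ ∈ E k, ∀ ζ, L k θ ζ = L k (θ₀ k) ζ) {x : ℕ → ∀ k, Z k}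
    (hx : IsTypical L θ₀ x)
    (hstray : ∀ k, Tendsto (fun i => strayBelief E (belief A L μ₀ x i) k) atTop (𝓝 0))
    {θ : Θ} {m : 𝒮 → ℝ}
    (hm : ∀ l, Tendsto (fun i => belief A L μ₀ x i (Sum.inl l) θ) atTop (𝓝 (m l))) (k : 𝓡) :
    Tendsto (fun i => belief A L μ₀ x i (Sum.inr k) θ) atTop
      (𝓝 (∑ l, influence A l k * m l)) := by
  obtain ⟨w, ρ, hw, hρ0, hρ1, hρ⟩ := hA.exists_contraction_weight
  obtain ⟨c, hc, hc1, hcL⟩ := exists_lower_bound L θ₀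
  have hw0 : ∀ k, 0 ≤ w k := fun k => zero_le_one.trans (hw k)
  set b : ℕ → 𝒮 ⊕ 𝓡 → ℝ := fun i l => belief A L μ₀ x i l θ with hb
  set ψ : ℕ → 𝒮 ⊕ 𝓡 → ℝ := fun i l =>
    bayesUpdate (L l) (belief A L μ₀ x i l) (x (i + 1) l) θ with hψ
  set y : 𝓡 → ℝ := fun k => ∑ l, influence A l k * m l with hy
  set z : 𝒮 ⊕ 𝓡 → ℝ := Sum.elim m y with hz
  -- The candidate limit is stationary for averaging without Bayesian updates. The deviation from it
  -- contracts by `ρ`, up to the error `η` of the updates and of the senders.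
  have hfix : ∀ k : 𝓡, y k = ∑ l, A l (Sum.inr k) * z l := by
    intro k
    rw [Fintype.sum_sum_type]
    simp only [hz, Sum.elim_inl, Sum.elim_inr, hy, Finset.mul_sum]
    rw [Finset.sum_comm (f := fun j l => A (Sum.inr j) (Sum.inr k) * (influence A l j * m l)),
      ← Finset.sum_add_distrib]
    refine Finset.sum_congr rfl fun l _ => ?_
    conv_lhs => rw [hA.influence_eq l k, add_mul, Finset.sum_mul]
    congr 1
    exact Finset.sum_congr rfl fun j _ => by ring
  have hψb : ∀ l, Tendsto (fun i => |ψ i l - b i l|) atTop (𝓝 0) := by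
    intro l
    have h1 := (hstray l).const_mul (2 / c)
    rw [mul_zero] at h1
    refine squeeze_zero (fun i => abs_nonneg _) (fun i => ?_) h1
    exact abs_bayesUpdate_sub_le (hL l) (belief_nonneg hA.leftStochastic hL hμ₀ x i l)
      (sum_belief_le_one hA.leftStochastic hμ₀ x i l) (hEL l) hc hc1
      (hcL l _ (hx (i + 1) (by omega) l)) θ
  have hbm : ∀ l, Tendsto (fun i => |b i (Sum.inl l) - m l|) atTop (𝓝 0) := fun l => by
    simpa using ((hm l).sub_const (m l)).abs
  set η : ℕ → ℝ := fun i =>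
    (∑ k, w k) * (∑ l, |ψ i l - b i l| + ∑ l, |b i (Sum.inl l) - m l|) with hη
  have hηlim : Tendsto η atTop (𝓝 0) := by
    have := ((tendsto_finsetSum Finset.univ fun l _ => hψb l).add
      (tendsto_finsetSum Finset.univ fun l _ => hbm l)).const_mul (∑ k, w k)
    simpa only [Finset.sum_const_zero, add_zero, mul_zero] using this
  have hstep : ∀ i, ∑ k, w k * |b (i + 1) (Sum.inr k) - y k| ≤
      ρ * ∑ k, w k * |b i (Sum.inr k) - y k| + η i := by
    intro i
    have h1 : ∀ k : 𝓡, |b (i + 1) (Sum.inr k) - y k| ≤ ∑ l, |ψ i l - b i l| +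
        ∑ l, A l (Sum.inr k) * |b i l - z l| := by
      intro k
      have e : b (i + 1) (Sum.inr k) - y k =
          ∑ l, A l (Sum.inr k) * (ψ i l - b i l) + ∑ l, A l (Sum.inr k) * (b i l - z l) := by
        rw [hfix k, ← Finset.sum_add_distrib]
        simp only [hb, belief_succ]
        rw [← Finset.sum_sub_distrib]
        exact Finset.sum_congr rfl fun l _ => by simp only [hψ]; ring
      rw [e]
      refine (abs_add_le _ _).trans (add_le_add ?_ ?_)
      · refine (Finset.abs_sum_le_sum_abs _ _).trans (Finset.sum_le_sum fun l _ => ?_)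
        rw [abs_mul, abs_of_nonneg (hA.nonneg _ _)]
        exact mul_le_of_le_one_left (abs_nonneg _)
          (Matrix.le_one_of_mem_colStochastic hA.leftStochastic)
      · refine (Finset.abs_sum_le_sum_abs _ _).trans (Finset.sum_le_sum fun l _ => ?_)
        rw [abs_mul, abs_of_nonneg (hA.nonneg _ _)]
    have h2 := sum_weight_mul_le hA hw hρ (q := fun l => |b i l - z l|) fun _ => abs_nonneg _
    calc _ ≤ ∑ k, w k * (∑ l, |ψ i l - b i l| + ∑ l, A l (Sum.inr k) * |b i l - z l|) :=
          Finset.sum_le_sum fun k _ => mul_le_mul_of_nonneg_left (h1 k) (hw0 k)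
      _ = (∑ k, w k) * ∑ l, |ψ i l - b i l| +
          ∑ l, (∑ k, A l (Sum.inr k) * w k) * |b i l - z l| := by
          simp only [mul_add, Finset.sum_add_distrib]
          congr 1
          · rw [Finset.sum_mul]
          · simp only [Finset.mul_sum, Finset.sum_mul]
            rw [Finset.sum_comm]
            exact Finset.sum_congr rfl fun _ _ => Finset.sum_congr rfl fun _ _ => by ring
      _ ≤ _ := by
          simp only [hz, Sum.elim_inl, Sum.elim_inr] at h2
          simp only [hη, mul_add]
          linarith
  have hlim := tendsto_zero_of_le_mul_add
    (x := fun i => ∑ k, w k * |b i (Sum.inr k) - y k|) hρ0.le hρ1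
    (fun i => Finset.sum_nonneg fun k _ => mul_nonneg (hw0 k) (abs_nonneg _)) hηlim hstep
  rw [tendsto_iff_norm_sub_tendsto_zero]
  refine squeeze_zero (fun i => norm_nonneg _) (fun i => ?_) hlim
  rw [Real.norm_eq_abs]
  exact (le_mul_of_one_le_left (abs_nonneg _) (hw k)).trans
    (Finset.single_le_sum (f := fun k => w k * |b i (Sum.inr k) - y k|)
      (fun k _ => mul_nonneg (hw0 k) (abs_nonneg _)) (Finset.mem_univ k))

end Receiving

/-! ### The senders as an autonomous network -/

section Restriction

variable {𝒮 𝓡 Θ : Type*} [Fintype 𝒮] [Fintype 𝓡] [Fintype Θ]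
  [DecidableEq 𝒮] [DecidableEq 𝓡] {S R : ℕ} {netS : 𝒮 → Fin S} {netR : 𝓡 → Fin R}
  {A : Matrix (𝒮 ⊕ 𝓡) (𝒮 ⊕ 𝓡) ℝ} {Z : 𝒮 ⊕ 𝓡 → Type*}
  {L : ∀ k, Θ → Z k → ℝ} {μ₀ : 𝒮 ⊕ 𝓡 → Θ → ℝ}

/-- The beliefs of the sending agents evolve independently of the receiving agents. -/
lemma IsWeaklyConnected.belief_inl (hA : IsWeaklyConnected netS netR A) (x : ℕ → ∀ k, Z k)
    (i : ℕ) (k : 𝒮) : belief A L μ₀ x i (Sum.inl k) =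
      belief (Z := fun l => Z (Sum.inl l)) A.toBlocks₁₁ (fun l => L (Sum.inl l))
        (fun l => μ₀ (Sum.inl l)) (fun j l => x j (Sum.inl l)) i k := by
  induction i generalizing k with
  | zero => rfl
  | succ i ih =>
    funext θ
    rw [belief_succ, belief_succ, Fintype.sum_sum_type]
    simp only [hA.no_feedback, zero_mul, Finset.sum_const_zero, add_zero, ih,
      Matrix.toBlocks₁₁, Matrix.of_apply]

omit [Fintype 𝒮] [Fintype 𝓡] [Fintype Θ] [DecidableEq 𝒮] [DecidableEq 𝓡] in
lemma IsSignalProcess.restrict_inl {Ω : Type*} [MeasurableSpace Ω] {P : Measure Ω}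
    [∀ k, MeasurableSpace (Z k)] {θ₀ : 𝒮 ⊕ 𝓡 → Θ} {ξ : ℕ → Ω → ∀ k, Z k}
    (hξ : IsSignalProcess P L θ₀ ξ) :
    IsSignalProcess (Z := fun l => Z (Sum.inl l)) P (fun l => L (Sum.inl l))
      (fun l => θ₀ (Sum.inl l)) (fun i ω l => ξ i ω (Sum.inl l)) where
  measurable i hi := measurable_pi_lambda _ fun l =>
    (measurable_pi_apply (Sum.inl l)).comp (hξ.measurable i hi)
  indep := hξ.indep.comp (fun _ x l => x (Sum.inl l)) fun _ =>
    measurable_pi_lambda _ fun l => measurable_pi_apply (Sum.inl l)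
  law i hi l ζ := hξ.law i hi (Sum.inl l) ζ

end Restriction

/-! ### The limit belief as a probability distribution -/

section Limit

variable {𝒮 𝓡 Θ : Type*} [Fintype 𝒮] [Fintype 𝓡] [DecidableEq 𝒮] [DecidableEq 𝓡]
  [DecidableEq Θ] {S R : ℕ} {netS : 𝒮 → Fin S} {netR : 𝓡 → Fin R}
  {A : Matrix (𝒮 ⊕ 𝓡) (𝒮 ⊕ 𝓡) ℝ}

omit [DecidableEq 𝒮] in
lemma sum_influence_mul_indicator (netS : 𝒮 → Fin S) (A : Matrix (𝒮 ⊕ 𝓡) (𝒮 ⊕ 𝓡) ℝ)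
    (θS : Fin S → Θ) (k : 𝓡) (θ : Θ) :
    ∑ l, influence A l k * (if θ = θS (netS l) then 1 else 0) = limitBelief netS A θS k θ := by
  simp only [limitBelief, Finset.sum_filter, Matrix.transpose_apply, mul_ite, mul_one, mul_zero]
  have h : ∀ l, (if θ = θS (netS l) then influence A l k else 0) =
      ∑ s, if netS l = s then (if θS s = θ then influence A l k else 0) else 0 := by
    intro l
    simp [eq_comm]
  simp only [h]
  rw [Finset.sum_comm]
  refine Finset.sum_congr rfl fun s _ => ?_
  by_cases hs : θS s = θ <;> simp [hs]

lemma IsWeaklyConnected.limitBelief_nonneg (hA : IsWeaklyConnected netS netR A) (θS : Fin S → Θ)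
    (k : 𝓡) (θ : Θ) : 0 ≤ limitBelief netS A θS k θ :=
  Finset.sum_nonneg fun _ _ => Finset.sum_nonneg fun l _ => hA.influence_nonneg l k

omit [DecidableEq 𝒮] in
lemma limitBelief_eq_zero {θS : Fin S → Θ} {θ : Θ} (hθ : θ ∉ Set.range θS) (k : 𝓡) :
    limitBelief netS A θS k θ = 0 := by
  rw [limitBelief, Finset.filter_false_of_mem fun s _ h => hθ ⟨s, h⟩, Finset.sum_empty]

lemma IsWeaklyConnected.sum_limitBelief (hA : IsWeaklyConnected netS netR A) (θS : Fin S → Θ)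
    (k : 𝓡) : ∑ θ ∈ Finset.univ.image θS, limitBelief netS A θS k θ = 1 := by
  simp only [← sum_influence_mul_indicator]
  rw [Finset.sum_comm]
  refine Eq.trans ?_ (hA.sum_influence k)
  refine Finset.sum_congr rfl fun l _ => ?_
  rw [← Finset.mul_sum, Finset.sum_ite_eq_of_mem' _ _ _ (by simp), mul_one]

end Limit

end SocialLearning

/-! ### Assembly of the theorem -/

theorem theorem2
    {𝒮 𝓡 Θ Ω : Type*} [Fintype 𝒮] [Fintype 𝓡] [Fintype Θ]
    [DecidableEq 𝒮] [DecidableEq 𝓡] [DecidableEq Θ]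
    {S R : ℕ} (netS : 𝒮 → Fin S) (netR : 𝓡 → Fin R)
    (A : Matrix (𝒮 ⊕ 𝓡) (𝒮 ⊕ 𝓡) ℝ)
    (hA : SocialLearning.IsWeaklyConnected netS netR A)
    -- finite signal spaces and likelihood functions
    {Z : 𝒮 ⊕ 𝓡 → Type*} [∀ k, Fintype (Z k)] [∀ k, MeasurableSpace (Z k)]
    [∀ k, MeasurableSingletonClass (Z k)]
    (L : ∀ k, Θ → Z k → ℝ) (hL : ∀ k θ, SocialLearning.IsProbVec (L k θ))
    -- the true states of the sending and of the receiving sub-networks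
    (θS : Fin S → Θ) (θR : Fin R → Θ)
    -- the prior beliefs
    (μ₀ : 𝒮 ⊕ 𝓡 → Θ → ℝ) (hμ₀ : ∀ k, SocialLearning.IsProbVec (μ₀ k))
    -- the observed signals
    [MeasurableSpace Ω] (P : Measure Ω) [IsProbabilityMeasure P]
    (ξ : ℕ → Ω → ∀ k, Z k)
    (hξ : SocialLearning.IsSignalProcess P L (Sum.elim (θS ∘ netS) (θR ∘ netR)) ξ)
    -- in each sending sub-network: a positive prior at the true state, prevailing signals,
    -- and global identifiability of the true state
    (hprior : ∀ s, ∃ k, netS k = s ∧ 0 < μ₀ (Sum.inl k) (θS s))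
    (hprev : ∀ k : 𝒮, ∃ ζ, SocialLearning.IsPrevailing (L (Sum.inl k)) (θS (netS k)) ζ)
    (hident : ∀ s, ⋂ k ∈ {k : 𝒮 | netS k = s},
      SocialLearning.indistinguishable (L (Sum.inl k)) (θS s) = {θS s})
    -- no receiving agent can distinguish the true state of a sending sub-network from its own
    (hindist : ∀ (k : 𝓡) (s : Fin S),
      θS s ∈ SocialLearning.indistinguishable (L (Sum.inr k)) (θR (netR k))) :
    -- `W` is well defined
    IsUnit (1 - A.toBlocks₂₂) ∧
    -- the beliefs of all agents converge almost surely, and the limits are related by `Wᵀ`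
    (∀ᵐ ω ∂P, ∃ μS : Θ → 𝒮 → ℝ, ∀ θ,
      Tendsto (fun i => fun k : 𝒮 =>
        SocialLearning.belief A L μ₀ (fun j => ξ j ω) i (Sum.inl k) θ) atTop (𝓝 (μS θ)) ∧
      μS θ = (fun k : 𝒮 => if θ = θS (netS k) then 1 else 0) ∧
      Tendsto (fun i => fun k : 𝓡 =>
        SocialLearning.belief A L μ₀ (fun j => ξ j ω) i (Sum.inr k) θ) atTop
        (𝓝 ((SocialLearning.influence A)ᵀ *ᵥ μS θ))) ∧
    -- the limit belief of each receiving agent is given by the block sums of its row of `Wᵀ`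
    (∀ k : 𝓡, ∀ᵐ ω ∂P, ∀ θ,
      Tendsto (fun i => SocialLearning.belief A L μ₀ (fun j => ξ j ω) i (Sum.inr k) θ) atTop
        (𝓝 (SocialLearning.limitBelief netS A θS k θ))) ∧
    -- and it is a probability distribution supported on the true states of the senders
    (∀ k : 𝓡, (∀ θ, 0 ≤ SocialLearning.limitBelief netS A θS k θ) ∧
      (∀ θ, θ ∉ Set.range θS → SocialLearning.limitBelief netS A θS k θ = 0) ∧
      ∑ θ ∈ Finset.univ.image θS, SocialLearning.limitBelief netS A θS k θ = 1) := by
  classical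
  set θ₀ : 𝒮 ⊕ 𝓡 → Θ := Sum.elim (θS ∘ netS) (θR ∘ netR) with hθ₀
  -- A receiver's own true state need not belong to its set; by `hindist` all states in the set have
  -- its true likelihood, and that is all the estimates use.
  let E : 𝒮 ⊕ 𝓡 → Finset Θ := Sum.elim (fun l => {θS (netS l)}) fun _ => Finset.univ.image θS
  have hE : ∀ l (k : 𝓡), E l ⊆ E (Sum.inr k) := by
    rintro (l | l) k
    · simp [E]
    · exact subset_rfl
  have hEL : ∀ k, ∀ θ ∈ E k, ∀ ζ, L k θ ζ = L k (θ₀ k) ζ := by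
    rintro (l | k) θ hθ ζ
    · rw [Finset.mem_singleton.1 hθ]
      rfl
    · obtain ⟨s, -, rfl⟩ := Finset.mem_image.1 hθ
      exact hindist k s ζ
  have hstrayS : ∀ (b : 𝒮 ⊕ 𝓡 → Θ → ℝ) l,
      SocialLearning.strayBelief E b (Sum.inl l) = 1 - b (Sum.inl l) (θS (netS l)) := by
    intro b l
    simp [SocialLearning.strayBelief, E]
  obtain ⟨π, hπ, hfix⟩ := hA.exists_pos_fixed_vector
  have hnet : ∀ l k : 𝒮, 0 < A.toBlocks₁₁ l k → netS l = netS k := fun l k h => by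
    by_contra hne
    exact h.ne' (hA.send_separate l k hne)
  have hsend : ∀ γ : ℝ, 0 < γ → γ ≤ 1 → ∀ᵐ ω ∂P, Summable fun i => SocialLearning.sendStray E
      (SocialLearning.belief A L μ₀ (fun j => ξ j ω) i) ^ (1 + γ) := by
    intro γ hγ0 hγ1
    have h := SocialLearning.ae_summable_rpow_wrong_belief hξ.restrict_inl hA.toBlocks₁₁_mem
      (fun l θ => hL (Sum.inl l) θ) (fun l => hμ₀ (Sum.inl l))
      (fun l k h => congrArg θS (hnet l k h)) hπ hfix
      (fun k => by
        obtain ⟨k₀, hk₀, hpos⟩ := hprior (netS k)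
        obtain ⟨_, ⟨h, hh, rfl⟩, hloop⟩ := (hA.send_strong (netS k)).2
        refine ⟨k₀, h, hA.send_connected (hk₀.trans hh.symm), hA.send_connected hh, hloop, ?_⟩
        simpa [hθ₀, hk₀] using hpos)
      hprev
      (fun k θ hne => by
        have h1 : θ ∉ ⋂ l ∈ {l : 𝒮 | netS l = netS k},
            SocialLearning.indistinguishable (L (Sum.inl l)) (θS (netS k)) := by
          rw [hident]
          exact hne
        simp only [Set.mem_iInter, not_forall] at h1
        obtain ⟨l, hl, h2⟩ := h1
        refine ⟨l, hA.send_connected hl.symm, ?_⟩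
        have hl' : netS l = netS k := hl
        simpa [hθ₀, hl'] using h2)
      hγ0 hγ1
    filter_upwards [h] with ω hω
    refine hω.congr fun i => ?_
    simp only [SocialLearning.sendStray, hstrayS, hA.belief_inl]
    rfl
  obtain ⟨w, ρ, hw, hρ0, hρ1, hρ⟩ := hA.exists_contraction_weight
  have hrecv := SocialLearning.ae_tendsto_recvStray hA hL hμ₀ hξ hE hEL hsend hw hρ0 hρ1 hρ
  have hmain : ∀ᵐ ω ∂P, ∀ θ,
      (∀ l : 𝒮, Tendsto (fun i =>
        SocialLearning.belief A L μ₀ (fun j => ξ j ω) i (Sum.inl l) θ) atTop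
        (𝓝 (if θ = θS (netS l) then 1 else 0))) ∧
      ∀ k : 𝓡, Tendsto (fun i =>
        SocialLearning.belief A L μ₀ (fun j => ξ j ω) i (Sum.inr k) θ) atTop
        (𝓝 (SocialLearning.limitBelief netS A θS k θ)) := by
    filter_upwards [hξ.ae_isTypical, hsend 1 one_pos le_rfl, hrecv] with ω htyp hsum hlim θ
    set b := SocialLearning.belief A L μ₀ (fun j => ξ j ω)
    have hb0 : ∀ i k θ, 0 ≤ b i k θ :=
      SocialLearning.belief_nonneg hA.leftStochastic hL hμ₀ _
    have hq0 : ∀ i k, 0 ≤ SocialLearning.strayBelief E (b i) k :=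
      SocialLearning.strayBelief_nonneg hA hL hμ₀ E _
    have hS0 : ∀ i, 0 ≤ SocialLearning.sendStray E (b i) := fun i =>
      Finset.sum_nonneg fun l _ => hq0 i _
    -- The exponent γ = 1 gives summable squares, which tend to zero.
    have hSlim : Tendsto (fun i => SocialLearning.sendStray E (b i)) atTop (𝓝 0) := by
      have h := (hsum.tendsto_atTop_zero).rpow_const (p := (1 + 1)⁻¹) (Or.inr (by positivity))
      rw [Real.zero_rpow (by positivity)] at h
      exact h.congr fun i => Real.rpow_rpow_inv (hS0 i) (by norm_num)
    have hstray : ∀ k, Tendsto (fun i => SocialLearning.strayBelief E (b i) k) atTop (𝓝 0) := by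
      rintro (l | k)
      · exact squeeze_zero (fun i => hq0 i _) (fun i => Finset.single_le_sum
          (f := fun l => SocialLearning.strayBelief E (b i) (Sum.inl l))
          (fun l _ => hq0 i _) (Finset.mem_univ l)) hSlim
      · exact squeeze_zero (fun i => hq0 i _) (fun i =>
          (le_mul_of_one_le_left (hq0 i _) (hw k)).trans (Finset.single_le_sum
          (f := fun k => w k * SocialLearning.strayBelief E (b i) (Sum.inr k))
          (fun k _ => mul_nonneg (zero_le_one.trans (hw k)) (hq0 i _)) (Finset.mem_univ k))) hlim
    have hm : ∀ l : 𝒮, Tendsto (fun i => b i (Sum.inl l) θ) atTop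
        (𝓝 (if θ = θS (netS l) then 1 else 0)) := by
      intro l
      have h := hstray (Sum.inl l)
      simp only [hstrayS] at h
      split_ifs with hθ
      · rw [hθ]
        simpa using h.const_sub 1
      · refine squeeze_zero (fun i => hb0 i _ _) (fun i => ?_) h
        have h1 := SocialLearning.sum_belief_le_one (L := L) hA.leftStochastic hμ₀
          (fun j => ξ j ω) i (Sum.inl l)
        have h2 := Finset.sum_le_sum_of_subset_of_nonneg
          (Finset.subset_univ {θ, θS (netS l)}) fun θ _ _ => hb0 i (Sum.inl l) θ
        rw [Finset.sum_pair hθ] at h2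
        linarith
    refine ⟨hm, fun k => ?_⟩
    rw [← SocialLearning.sum_influence_mul_indicator]
    exact SocialLearning.tendsto_belief_recv hA hL hμ₀ hEL htyp hstray hm k
  refine ⟨hA.isUnit_one_sub, ?_, ?_, fun k => ⟨hA.limitBelief_nonneg θS k,
    fun θ hθ => SocialLearning.limitBelief_eq_zero hθ k, hA.sum_limitBelief θS k⟩⟩
  · filter_upwards [hmain] with ω hω
    refine ⟨fun θ l => if θ = θS (netS l) then 1 else 0, fun θ =>
      ⟨tendsto_pi_nhds.2 (hω θ).1, rfl, tendsto_pi_nhds.2 fun k => ?_⟩⟩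
    have h := (hω θ).2 k
    rw [← SocialLearning.sum_influence_mul_indicator] at h
    exact h
  · intro k
    filter_upwards [hmain] with ω hω θ using (hω θ).2 k
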